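/- Let $N,p\ge 1$ be integers. In $\mathfrak{gl}(p)$ over $\mathbb C$ put $e_-=\sum_{k=1}^{p-1}E_{k+1,k}$, $M_{j,j}=\sum_{k=1}^{p-j}\frac{(k+j-1)!\,(p-k)!}{(k-1)!\,(p-k-j)!}E_{k,k+j}$ and $M_{j,m-1}=[e_-,M_{j,m}]$ for $0\le j\le p-1$, $-j<m\le j$. Write the generic $Np\times Np$ matrix as $\mathbb J=\sum_{a,b=1}^N\sum_{j=0}^{p-1}\sum_{m=-j}^{j}J^{ab}_{jm}\,E_{ab}\otimes M_{j,m}$ and equip the polynomials in its entries with the Poisson bracket of $\mathfrak{gl}(Np)$, $\{x_{AB},x_{CD}\}=\delta_{BC}x_{AD}-\delta_{AD}x_{CB}$, equivalently $\{\mathrm{tr}(\lambda\mathbb J),\mathbb J\}=[\lambda,\mathbb J]$. The classical algebra $\mathcal W_p(N)=\mathcal W[gl(Np),N.sl(p)]$ is the polynomial algebra $\mathbb C[W^{ab}_j:\ 0\le j<p,\ 1\le a,b\le N]$ with the Poisson bracket, extended as a biderivation from the generators, $\{W_j^{ab},W_\ell^{cd}\}=\{J^{ab}_{jj},J^{cd}_{\ell\ell}\}_*$,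 where $\{\cdot,\cdot\}_*$ is the Dirac bracket for the constraints which fix all $J^{ab}_{jm}$ with $m<j$ to their values at $\mathbb J=1_N\otimes e_-$, that is, for $$\mathbb J|_{g.f.}=1_N\otimes e_-+\sum_{a,b}\sum_{j=0}^{p-1}W_j^{ab}\,E_{ab}\otimes M_{j,j}.$$ Let $W_j$ be the $N\times N$ matrix $(W_j^{ab})$, with $W_j=0$ for $j\ge p$. Then there exist two families of elements $\{{}^{\pm}\bar W_j^{ab}\}_{j\ge 0,\ 1\le a,b\le N}$ of $\mathcal W_p(N)$ such that, for either sign: 1. $\bar W_0\equiv{}^{\pm}\bar W_0=p\,W_0$ and ${}^{\pm}\bar W_1=\pm\frac{p(p^2-1)}{6}\,W_1+\frac{p(p\pm1)}{2}\,W_0W_0$. 2. For some complex numbers ${}^{\pm}\alpha^{n,j}_{\vec s}$ and all $j\ge 0$, $${}^{\pm}\bar W_j^{ab}=\sum_{n=1}^{j+1}\ \sum_{|\vec s|=j+1-n}{}^{\pm}\alpha^{n,j}_{\vec s}\,(W_{s_1}\cdots W_{s_n})^{ab},$$ where $\vec s=(s_1,\dots,s_n)$ runs over the $n$-tuples of non-negative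 integers with $|\vec s|=s_1+\dots+s_n=j+1-n$. In particular ${}^{\pm}\bar W_j^{ab}$ is a polynomial of degree at most $j+1$ in the generators $W_s^{cd}$; the degree of ${}^{+}\bar W_j^{ab}$ is exactly $j+1$ for all $j$, and that of ${}^{-}\bar W_j^{ab}$ is exactly $j+1$ for all $j<p$. 3. For all $a,b,c,d\in\{1,\dots,N\}$ and all $j\ge 0$, $$\{\bar W_0^{ab},{}^{\pm}\bar W_j^{cd}\}=\delta^{cb}\,{}^{\pm}\bar W_j^{ad}-\delta^{ad}\,{}^{\pm}\bar W_j^{cb},$$ $$\{{}^{\pm}\bar W_1^{ab},{}^{\pm}\bar W_j^{cd}\}=\delta^{cb}\,{}^{\pm}\bar W_{j+1}^{ad}-\delta^{ad}\,{}^{\pm}\bar W_{j+1}^{cb}+\bar W_0^{cb}\,{}^{\pm}\bar W_j^{ad}-{}^{\pm}\bar W_j^{cb}\,\bar W_0^{ad}.$$ 4. The elements ${}^{\pm}\bar W_j^{ab}$ with $0\le j<p$ and $1\le a,b\le N$ form a basis of generators of $\mathcal W_p(N)$: they are algebraically independent and generate $\mathcal W_p(N)$ as an algebra. The other ${}^{\pm}\bar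 W_j^{ab}$, $j\ge p$, are polynomials in them. -/

import Mathlib

open scoped Kronecker

namespace FiniteW

/-- The biderivation of a polynomial ring with prescribed values `π i k` on the pairs
`(X i, X k)` of variables: `{f, g} = ∑ ∂f/∂X_i * ∂g/∂X_k * π i k`. -/
noncomputable def biderivation {σ : Type} [Fintype σ]
    (π : σ → σ → MvPolynomial σ ℂ) (f g : MvPolynomial σ ℂ) : MvPolynomial σ ℂ :=
  ∑ i, ∑ k, MvPolynomial.pderiv i f * MvPolynomial.pderiv k g * π i k

/-! ### The principal `sl(2)` in `gl(p)`; rows and columns are numbered from `0` -/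

/-- `e₋ = ∑ E_{k+1,k}`. -/
def eMinus (p : ℕ) : Matrix (Fin p) (Fin p) ℂ :=
  Matrix.of fun k l => if (k : ℕ) = l + 1 then 1 else 0

/-- The highest weight matrix `M_{j,j} = ∑ a_k E_{k,k+j}`; with `k` counted from `1`,
`a_k = (k+j-1)! (p-k)! / ((k-1)! (p-k-j)!)`. -/
noncomputable def highest (p j : ℕ) : Matrix (Fin p) (Fin p) ℂ :=
  Matrix.of fun k l =>
    if (l : ℕ) = k + j then
      ((Nat.factorial (k + j) : ℂ) * Nat.factorial (p - 1 - k)) /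
        (Nat.factorial k * Nat.factorial (p - 1 - k - j))
    else 0

/-- `M_{j,m}`, for `-j ≤ m ≤ j`, given by `M_{j,m-1} = [e₋, M_{j,m}]` from `M_{j,j}`. -/
noncomputable def multiplet (p j : ℕ) (m : ℤ) : Matrix (Fin p) (Fin p) ℂ :=
  (fun A => eMinus p * A - A * eMinus p)^[((j : ℤ) - m).toNat] (highest p j)

/-- `M^{jm}_{ab} = E_{ab} ⊗ M_{j,m}`. -/
noncomputable def glBasis (N p j : ℕ) (m : ℤ) (a b : Fin N) :
    Matrix (Fin N × Fin p) (Fin N × Fin p) ℂ :=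
  Matrix.single a b (1 : ℂ) ⊗ₖ multiplet p j m

/-! ### Polynomial functions on `gl(Np)` -/

/-- Polynomials in the entries of an `Np × Np` matrix. -/
abbrev Amb (N p : ℕ) : Type :=
  MvPolynomial ((Fin N × Fin p) × (Fin N × Fin p)) ℂ

/-- The generic matrix `𝕁` of the generators of `gl(Np)`. -/
noncomputable def genericMatrix (N p : ℕ) :
    Matrix (Fin N × Fin p) (Fin N × Fin p) (Amb N p) :=
  Matrix.of fun A B => MvPolynomial.X (A, B)

/-- The Poisson bracket of `gl(Np)`, i.e. `{tr(λ𝕁), 𝕁} = [λ, 𝕁]`; on the entries,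
`{x_{AB}, x_{CD}} = δ_{BC} x_{AD} - δ_{AD} x_{CB}`. -/
noncomputable def glBracket (N p : ℕ) : Amb N p → Amb N p → Amb N p :=
  biderivation fun x y =>
    (if x.2 = y.1 then genericMatrix N p x.1 y.2 else 0) -
      (if x.1 = y.2 then genericMatrix N p y.1 x.2 else 0)

/-- The coordinate `J^{ab}_{jm}` in `𝕁 = ∑ J^{ab}_{jm} M^{jm}_{ab}`, extracted with the trace form,
for which `M^{jm}_{ab}` pairs nontrivially with `M^{j,-m}_{ba}` only. -/
noncomputable def coord (N p j : ℕ) (m : ℤ) (a b : Fin N) : Amb N p :=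
  MvPolynomial.C ((multiplet p j m * multiplet p j (-m)).trace)⁻¹ *
    ((glBasis N p j (-m) b a).map MvPolynomial.C * genericMatrix N p).trace

/-! ### The highest weight gauge, the Dirac bracket and the algebra `W_p(N)` -/

/-- The polynomial algebra underlying the classical `W_p(N)`; the variable `(j, a, b)`
is the generator `W_j^{ab}`, `0 ≤ j < p`. -/
abbrev WAlgebra (N p : ℕ) : Type := MvPolynomial (Fin p × Fin N × Fin N) ℂ

/-- The matrix `W_j = (W_j^{ab})`, with `W_j = 0` for `j ≥ p` (as `M_{j,j} = 0` then). -/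
noncomputable def W (N p j : ℕ) : Matrix (Fin N) (Fin N) (WAlgebra N p) :=
  Matrix.of fun a b => if h : j < p then MvPolynomial.X (⟨j, h⟩, a, b) else 0

/-- `ε₋ = 1 ⊗ e₋`. -/
def epsMinus (N p : ℕ) : Matrix (Fin N × Fin p) (Fin N × Fin p) ℂ :=
  (1 : Matrix (Fin N) (Fin N) ℂ) ⊗ₖ eMinus p

/-- The gauge fixed matrix `ε₋ + ∑ W_j^{ab} M^{jj}_{ab}`. -/
noncomputable def gaugeFixed (N p : ℕ) :
    Matrix (Fin N × Fin p) (Fin N × Fin p) (WAlgebra N p) :=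
  (epsMinus N p).map MvPolynomial.C +
    ∑ j : Fin p, ∑ a : Fin N, ∑ b : Fin N,
      W N p j a b • (glBasis N p j (j : ℕ) a b).map MvPolynomial.C

/-- Imposing all constraints: restriction of a polynomial to the gauge fixed matrices. -/
noncomputable def impose (N p : ℕ) : Amb N p →ₐ[ℂ] WAlgebra N p :=
  MvPolynomial.aeval fun x => gaugeFixed N p x.1 x.2

/-- Labels `(j, m, a, b)` with `0 ≤ j < p` and `-j ≤ m < j` of the constraints. -/
abbrev ConstraintIndex (N p : ℕ) : Type :=
  ((j : Fin p) × Finset.Ico (-((j : ℕ) : ℤ)) ((j : ℕ) : ℤ)) × Fin N × Fin N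

/-- The constraint `φ = J^{ab}_{jm} - (its value at ε₋)`, for `m < j`. -/
noncomputable def constraint (N p : ℕ) (α : ConstraintIndex N p) : Amb N p :=
  coord N p α.1.1 α.1.2 α.2.1 α.2.2 -
    MvPolynomial.C (MvPolynomial.eval (fun x => epsMinus N p x.1 x.2)
      (coord N p α.1.1 α.1.2 α.2.1 α.2.2))

/-- `Δ_{αβ} = {φ_α, φ_β}`, with the constraints imposed afterwards. -/
noncomputable def diracMatrix (N p : ℕ) :
    Matrix (ConstraintIndex N p) (ConstraintIndex N p) (WAlgebra N p) :=
  Matrix.of fun α β => impose N p (glBracket N p (constraint N p α) (constraint N p β))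

/-- The Dirac bracket `{f, g}_* = {f, g} - ∑ {f, φ_α} (Δ⁻¹)_{αβ} {φ_β, g}`, with the constraints
imposed afterwards. -/
noncomputable def diracBracket (N p : ℕ) (f g : Amb N p) : WAlgebra N p :=
  impose N p (glBracket N p f g) -
    ∑ α, ∑ β, impose N p (glBracket N p f (constraint N p α)) * (diracMatrix N p)⁻¹ α β *
      impose N p (glBracket N p (constraint N p β) g)

/-- The Poisson bracket of `W_p(N)`: the biderivation with
`{W_j^{ab}, W_l^{cd}} = {J^{ab}_{jj}, J^{cd}_{ll}}_*`. -/
noncomputable def wBracket (N p : ℕ) : WAlgebra N p → WAlgebra N p → WAlgebra N p :=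
  biderivation fun x y =>
    diracBracket N p (coord N p x.1 (x.1 : ℕ) x.2.1 x.2.2) (coord N p y.1 (y.1 : ℕ) y.2.1 y.2.2)

/-- The Kronecker delta. -/
noncomputable def delta (N p : ℕ) (a b : Fin N) : WAlgebra N p := if a = b then 1 else 0

end FiniteW

namespace FiniteW

open Matrix

/-! ### The principal `sl(2)` -/

/-! Write p = q + 1 and view matrices as p × p arrays of N × N blocks. Everything comes from the
corner of 𝕁^n: the block in the last row and first column. A constraint with m < 0 is, up to a
constant, a combination of entries strictly below the block diagonal, and bracketing with such an
entry acts on 𝕁^n by a commutator that does not reach the corner. So corners commute with these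
constraints (`glBracket_constraint_pow`).

This half of the constraints suffices. On the gauge slice Δ_{αβ} vanishes for m_α + m_β < -1 and is
an invertible constant block along m_α + m_β = -1. Hence Δ is antitriangular, and Δ⁻¹ vanishes where
both labels have m ≥ 0 (`inv_diracMatrix_apply_eq_zero`). The Dirac correction for two corners is
therefore zero, and their bracket is the quadratic formula `glBracket_pow_pow` restricted to the
slice (`wBracket_corner`). Using powers of 𝕁 as representatives is legitimate because the
constraints are Casimirs of the Dirac bracket, which thus sees only restrictions
(`wBracket_impose`).

Let J be the gauge fixed matrix. The corner of J^n is 0 for n < q and 1 for n = q, so with t_k the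
corner of J^(q+k) and ⁺W̄_j = t_{j+1}, only boundary terms of the quadratic formula survive in the
brackets of t_1 and t_2; they are the asserted ones.

If W_s has weight s + 1, then t_k is homogeneous of weight k, and for j < p the coefficient of W_j
in t_{j+1} is nonzero by positivity. The system is triangular, so the new elements generate; being
as many as the variables, they are algebraically independent. Setting W_s = 0 for s > 0 and all
entries of W_0 equal makes J a sum of two commuting matrices, and binomial coefficients give the
exact degrees.

The second family consists of the coefficients of the inverse of T(x) = ∑ (-1)^k t_k x^k. From
δ(T⁻¹) = -T⁻¹ δ(T) T⁻¹ its brackets follow (`derivation_altInverse`). Its specialisation involves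
the coefficients of (1 + x)^p, which vanish beyond x^p; hence the restriction j < p on its degrees.
-/

lemma eMinus_apply (p : ℕ) (k l : Fin p) :
    eMinus p k l = if (k : ℕ) = l + 1 then 1 else 0 := rfl

lemma highest_apply_of_eq {p j : ℕ} {k l : Fin p} (h : (l : ℕ) = k + j) :
    highest p j k l = ((Nat.factorial (k + j) : ℂ) * Nat.factorial (p - 1 - k)) /
        (Nat.factorial k * Nat.factorial (p - 1 - k - j)) := by
  simp [highest, h]

lemma highest_apply_of_ne {p j : ℕ} {k l : Fin p} (h : (l : ℕ) ≠ k + j) :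
    highest p j k l = 0 := by
  simp [highest, h]

lemma highest_zero (p : ℕ) : highest p 0 = 1 := by
  ext k l
  by_cases h : k = l
  · subst h
    rw [highest_apply_of_eq (by simp)]
    have := Nat.factorial_ne_zero k
    have := Nat.factorial_ne_zero (p - 1 - k)
    simp only [add_zero, Nat.sub_zero, one_apply_eq]
    field_simp
  · rw [highest_apply_of_ne (by simpa [Fin.ext_iff, eq_comm] using h), one_apply_ne h]

lemma highest_one_apply {p : ℕ} {k l : Fin p} (h : (l : ℕ) = k + 1) :
    highest p 1 k l = ((k : ℂ) + 1) * (p - 1 - k) := by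
  rw [highest_apply_of_eq h]
  obtain ⟨r, hr⟩ : ∃ r, p = k + 2 + r := ⟨p - (k + 2), by omega⟩
  have h1 : p - 1 - (k : ℕ) = r + 1 := by omega
  have h2 : p - 1 - (k : ℕ) - 1 = r := by omega
  have h3 : (p : ℂ) = k + 2 + r := by exact_mod_cast hr
  rw [h2, h1, h3, Nat.factorial_succ, Nat.factorial_succ]
  have := Nat.factorial_ne_zero k
  have := Nat.factorial_ne_zero r
  push_cast
  field_simp
  ring

/-- The factorials telescope along the only path k → k+j → k+j+1. Hence M_{j,j} is a power of
M_{1,1}, and the multiplets can be studied with the Leibniz rule for ad e₋ alone. -/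
lemma highest_succ (p j : ℕ) : highest p (j + 1) = highest p j * highest p 1 := by
  ext k l
  rw [mul_apply]
  by_cases h : (l : ℕ) = k + (j + 1)
  · have hm : (k : ℕ) + j < p := by omega
    rw [Finset.sum_eq_single (⟨k + j, hm⟩ : Fin p)]
    · rw [highest_apply_of_eq h, highest_apply_of_eq (by simp), highest_apply_of_eq (by simp; omega)]
      have e1 : p - 1 - (k : ℕ) - (j + 1) = p - 1 - (k + j) - 1 := by omega
      have e2 : p - 1 - (k : ℕ) - j = p - 1 - (k + j) := by omega
      simp only [e1, e2]
      have := Nat.factorial_ne_zero k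
      have := Nat.factorial_ne_zero (k + j)
      have := Nat.factorial_ne_zero (p - 1 - (k + j))
      have := Nat.factorial_ne_zero (p - 1 - (k + j) - 1)
      rw [← add_assoc]
      field_simp
    · intro m _ hne
      rw [highest_apply_of_ne (fun hh => hne (Fin.ext hh)), zero_mul]
    · simp
  · rw [highest_apply_of_ne h]
    symm
    refine Finset.sum_eq_zero fun m _ => ?_
    by_cases h' : (m : ℕ) = k + j
    · rw [highest_apply_of_ne (l := l) (by omega), mul_zero]
    · rw [highest_apply_of_ne h', zero_mul]

/-- The adjoint action of `e₋`. -/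
noncomputable def adMinus (p : ℕ) (A : Matrix (Fin p) (Fin p) ℂ) : Matrix (Fin p) (Fin p) ℂ :=
  eMinus p * A - A * eMinus p

lemma multiplet_eq (p j : ℕ) (m : ℤ) :
    multiplet p j m = (adMinus p)^[((j : ℤ) - m).toNat] (highest p j) := rfl

lemma multiplet_self (p j : ℕ) : multiplet p j j = highest p j := by
  simp [multiplet_eq]

lemma adMinus_multiplet (p j : ℕ) (m : ℤ) (hm : m ≤ j) :
    adMinus p (multiplet p j m) = multiplet p j (m - 1) := by
  rw [multiplet_eq, multiplet_eq, ← Function.iterate_succ_apply' (adMinus p)]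
  congr 2
  omega

lemma adMinus_mul (p : ℕ) (A B : Matrix (Fin p) (Fin p) ℂ) :
    adMinus p (A * B) = adMinus p A * B + A * adMinus p B := by
  simp only [adMinus]; noncomm_ring

lemma adMinus_add (p : ℕ) (A B : Matrix (Fin p) (Fin p) ℂ) :
    adMinus p (A + B) = adMinus p A + adMinus p B := by
  simp only [adMinus]; noncomm_ring

lemma adMinus_smul (p : ℕ) (c : ℂ) (A : Matrix (Fin p) (Fin p) ℂ) :
    adMinus p (c • A) = c • adMinus p A := by
  simp only [adMinus, Matrix.mul_smul, Matrix.smul_mul, smul_sub]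

lemma adMinus_zero (p : ℕ) : adMinus p 0 = 0 := by
  simp [adMinus]

lemma adMinus_highest_one (p : ℕ) :
    adMinus p (highest p 1) = diagonal fun k : Fin p => (2 * (k : ℂ) - p + 1) := by
  ext k l
  have hL : (eMinus p * highest p 1) k l = if k = l then (k : ℂ) * (p - k) else 0 := by
    rw [mul_apply]
    rcases Nat.eq_zero_or_pos (k : ℕ) with hk | hk
    · rw [Finset.sum_eq_zero]
      · simp [hk]
      · intro m _
        simp [eMinus_apply, hk]
    · rw [Finset.sum_eq_single (⟨k - 1, by omega⟩ : Fin p)]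
      · rw [eMinus_apply, if_pos (by simp; omega), one_mul]
        split_ifs with h
        · subst h
          rw [highest_one_apply (by simp; omega)]
          simp only
          rw [Nat.cast_sub (by omega)]
          push_cast
          ring
        · rw [highest_apply_of_ne]
          simp only
          intro h'
          exact h (Fin.ext (by omega))
      · intro m _ hne
        rw [eMinus_apply, if_neg, zero_mul]
        intro h'
        exact hne (Fin.ext (by simp; omega))
      · simp
  have hR : (highest p 1 * eMinus p) k l = if k = l then ((k : ℂ) + 1) * (p - 1 - k) else 0 := by
    rw [mul_apply]
    by_cases hk : (k : ℕ) + 1 < p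
    · rw [Finset.sum_eq_single (⟨k + 1, hk⟩ : Fin p)]
      · rw [highest_one_apply (by simp), eMinus_apply]
        simp [Fin.ext_iff]
      · intro m _ hne
        rw [highest_apply_of_ne (fun hh => hne (Fin.ext hh)), zero_mul]
      · simp
    -- In the last row the product has no contribution, in agreement with the vanishing factor p - 1
    -- - k.
    · have : (p : ℂ) - 1 - k = 0 := by
        have : (p : ℂ) = k + 1 := by exact_mod_cast (show p = k + 1 by omega)
        rw [this]; ring
      rw [this, mul_zero, ite_self, Finset.sum_eq_zero]
      intro m _
      rw [highest_apply_of_ne (by omega), zero_mul]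
  rw [adMinus, Matrix.sub_apply, hL, hR, diagonal_apply]
  split_ifs
  · ring
  · simp

lemma adMinus_adMinus_highest_one (p : ℕ) :
    adMinus p (adMinus p (highest p 1)) = (-2 : ℂ) • eMinus p := by
  rw [adMinus_highest_one]
  ext k l
  rw [adMinus, Matrix.sub_apply, mul_diagonal, diagonal_mul, Matrix.smul_apply, eMinus_apply]
  split_ifs with h
  · rw [h]; push_cast; simp; ring
  · simp

lemma adMinus_eMinus (p : ℕ) : adMinus p (eMinus p) = 0 := sub_self _

/-- The Leibniz expansion stops after three terms because ad² M_{1,1} = -2e₋ is killed by ad e₋. The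
last coefficient is -2 times the binomial coefficient of n + 2 over 2. -/
lemma adMinus_iterate_mul_highest_one (p : ℕ) (A : Matrix (Fin p) (Fin p) ℂ) (n : ℕ) :
    (adMinus p)^[n + 2] (A * highest p 1) =
      (adMinus p)^[n + 2] A * highest p 1 +
        ((n + 2 : ℕ) : ℂ) • ((adMinus p)^[n + 1] A * adMinus p (highest p 1)) -
        ((n + 2 : ℂ) * (n + 1)) • ((adMinus p)^[n] A * eMinus p) := by
  have h3 : adMinus p (adMinus p (highest p 1)) = -((2 : ℂ) • eMinus p) := by
    rw [adMinus_adMinus_highest_one, neg_smul]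
  induction n with
  | zero =>
    simp only [Function.iterate_succ_apply', Function.iterate_zero, id_eq, adMinus_mul,
      adMinus_add, h3]
    simp only [mul_neg, Matrix.mul_smul, Nat.cast_ofNat, Nat.zero_add, CharP.cast_eq_zero]
    module
  | succ n ih =>
    rw [Function.iterate_succ_apply' _ (n + 2), ih]
    rw [sub_eq_add_neg, ← neg_smul]
    simp only [adMinus_add, adMinus_smul, adMinus_mul, h3, adMinus_eMinus,
      ← Function.iterate_succ_apply' (adMinus p)]
    simp only [mul_neg, Matrix.mul_smul, mul_zero, Nat.succ_eq_add_one]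
    push_cast
    module

/-- The multiplet of M_{l,l} ends at a nonzero multiple of e₋^l. In the inductive step the first two
Leibniz terms contain at least 2l + 1 applications of ad e₋ to M_{l,l} and vanish; the third
multiplies e₋^l by e₋. -/
lemma adMinus_iterate_highest (p l : ℕ) :
    (∃ c : ℂ, c ≠ 0 ∧ (adMinus p)^[2 * l] (highest p l) = c • eMinus p ^ l) ∧
      (adMinus p)^[2 * l + 1] (highest p l) = 0 := by
  induction l with
  | zero =>
    refine ⟨⟨1, one_ne_zero, by simp [highest_zero]⟩, ?_⟩
    simp [highest_zero, adMinus]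
  | succ l ih =>
    obtain ⟨⟨c, hc, h0⟩, h1⟩ := ih
    have h2 : (adMinus p)^[2 * l + 2] (highest p l) = 0 := by
      rw [Function.iterate_succ_apply', h1, adMinus_zero]
    have h3 : (adMinus p)^[2 * l + 3] (highest p l) = 0 := by
      rw [Function.iterate_succ_apply', h2, adMinus_zero]
    constructor
    · refine ⟨-(((2 * l : ℕ) + 2 : ℂ) * ((2 * l : ℕ) + 1) * c), ?_, ?_⟩
      · have a1 : ((2 * l : ℕ) + 2 : ℂ) ≠ 0 := by exact_mod_cast (by omega : 2 * l + 2 ≠ 0)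
        have a2 : ((2 * l : ℕ) + 1 : ℂ) ≠ 0 := by exact_mod_cast (by omega : 2 * l + 1 ≠ 0)
        exact neg_ne_zero.mpr (mul_ne_zero (mul_ne_zero a1 a2) hc)
      · rw [show 2 * (l + 1) = 2 * l + 2 by ring, highest_succ, adMinus_iterate_mul_highest_one,
          h0, h1, h2, pow_succ, Matrix.smul_mul, smul_smul]
        simp
    · rw [show 2 * (l + 1) + 1 = (2 * l + 1) + 2 by ring, highest_succ,
        adMinus_iterate_mul_highest_one, h1, h2, h3]
      simp

lemma trace_adMinus_mul (p : ℕ) (A B : Matrix (Fin p) (Fin p) ℂ) :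
    (adMinus p A * B).trace = -(A * adMinus p B).trace := by
  simp only [adMinus, sub_mul, mul_sub, trace_sub]
  rw [← mul_assoc, ← mul_assoc, mul_assoc (eMinus p), trace_mul_comm (eMinus p), neg_sub]

lemma trace_adMinus_iterate_mul (p n : ℕ) (A B : Matrix (Fin p) (Fin p) ℂ) :
    ((adMinus p)^[n] A * B).trace = (-1) ^ n * (A * (adMinus p)^[n] B).trace := by
  induction n generalizing B with
  | zero => simp
  | succ n ih =>
    rw [Function.iterate_succ_apply', trace_adMinus_mul, ih, Function.iterate_succ_apply]
    ring

lemma eMinus_pow_apply (p n : ℕ) (k l : Fin p) :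
    (eMinus p ^ n) k l = if (k : ℕ) = l + n then 1 else 0 := by
  induction n generalizing l with
  | zero => simp [one_apply, Fin.ext_iff]
  | succ n ih =>
    rw [pow_succ, mul_apply]
    by_cases hl : (l : ℕ) + 1 < p
    · rw [Finset.sum_eq_single (⟨l + 1, hl⟩ : Fin p)]
      · rw [ih, eMinus_apply]
        simp [add_assoc, add_comm 1 n]
      · intro m _ hne
        rw [eMinus_apply, if_neg (fun hh => hne (Fin.ext hh)), mul_zero]
      · simp
    · rw [if_neg (by omega), Finset.sum_eq_zero]
      intro m _
      rw [eMinus_apply, if_neg (by omega), mul_zero]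

open scoped ComplexOrder in
lemma highest_nonneg (p j : ℕ) (k l : Fin p) : 0 ≤ highest p j k l := by
  by_cases h : (l : ℕ) = k + j
  · rw [highest_apply_of_eq h]
    positivity
  · rw [highest_apply_of_ne h]

open scoped ComplexOrder in
lemma highest_pos (p j : ℕ) (k l : Fin p) (h : (l : ℕ) = k + j) : 0 < highest p j k l := by
  rw [highest_apply_of_eq h]
  positivity

open scoped ComplexOrder in
-- All entries are nonnegative, so nothing cancels, and the entry (0, j) of M_{j,j} contributes a
-- positive term.
lemma trace_highest_mul_eMinus_pow_ne_zero (p j : ℕ) (hj : j < p) :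
    (highest p j * eMinus p ^ j).trace ≠ 0 := by
  apply ne_of_gt
  rw [trace]
  have hnn : ∀ k l : Fin p, 0 ≤ highest p j k l * (eMinus p ^ j) l k := fun k l => by
    rw [eMinus_pow_apply]
    split_ifs
    · simpa using highest_nonneg p j k l
    · simp
  refine Finset.sum_pos' (fun k _ => ?_) ⟨⟨0, by omega⟩, Finset.mem_univ _, ?_⟩
  · rw [diag_apply, mul_apply]
    exact Finset.sum_nonneg fun l _ => hnn k l
  · rw [diag_apply, mul_apply]
    refine Finset.sum_pos' (fun l _ => hnn _ l) ⟨⟨j, hj⟩, Finset.mem_univ _, ?_⟩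
    rw [eMinus_pow_apply, if_pos (by simp), mul_one]
    exact highest_pos _ _ _ _ (by simp)

/-! ### The grading and the trace form -/

lemma multiplet_apply_eq_zero (p j : ℕ) (m : ℤ) (hm : m ≤ j) (k l : Fin p)
    (h : (l : ℤ) - k ≠ m) : multiplet p j m k l = 0 := by
  obtain ⟨n, rfl⟩ : ∃ n : ℕ, m = j - n := ⟨((j : ℤ) - m).toNat, by omega⟩
  induction n generalizing k l with
  | zero =>
    simp only [CharP.cast_eq_zero, sub_zero] at *
    rw [multiplet_self, highest_apply_of_ne (by omega)]
  | succ n ih =>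
    have : (j : ℤ) - (n + 1 : ℕ) = (j - n) - 1 := by push_cast; ring
    rw [this, ← adMinus_multiplet _ _ _ (by omega), adMinus, Matrix.sub_apply, mul_apply, mul_apply,
      Finset.sum_eq_zero, Finset.sum_eq_zero, sub_zero]
    · intro x _
      by_cases hx : (x : ℕ) = l + 1
      · rw [ih _ _ (by omega) (by push_cast at h; omega), zero_mul]
      · rw [eMinus_apply, if_neg hx, mul_zero]
    · intro x _
      by_cases hx : (k : ℕ) = x + 1
      · rw [ih _ _ (by omega) (by push_cast at h; omega), mul_zero]
      · rw [eMinus_apply, if_neg hx, zero_mul]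

lemma trace_multiplet_mul_of_add_ne_zero (p j l : ℕ) (m n : ℤ) (hm : m ≤ j) (hn : n ≤ l)
    (h : m + n ≠ 0) : (multiplet p j m * multiplet p l n).trace = 0 := by
  refine Finset.sum_eq_zero fun k _ => ?_
  rw [diag_apply, mul_apply]
  refine Finset.sum_eq_zero fun x _ => ?_
  by_cases hx : (x : ℤ) - k = m
  · rw [multiplet_apply_eq_zero p l n hn _ _ (by omega), mul_zero]
  · rw [multiplet_apply_eq_zero p j m hm _ _ hx, zero_mul]

lemma trace_multiplet_mul (p j l : ℕ) (m n : ℤ) :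
    (multiplet p j m * multiplet p l n).trace = (-1) ^ ((j : ℤ) - m).toNat *
      (highest p j * (adMinus p)^[((j : ℤ) - m).toNat + ((l : ℤ) - n).toNat]
        (highest p l)).trace := by
  rw [multiplet_eq, multiplet_eq, trace_adMinus_iterate_mul, Function.iterate_add_apply]

/-- Invariance of the trace form moves every ad e₋ to the second factor. For opposite weights there
are j + l ≥ 2l + 1 of them, which kills M_{l,l}. -/
lemma trace_multiplet_mul_of_lt (p j l : ℕ) (m n : ℤ) (hm : m ≤ j) (hn : n ≤ l) (h : l < j) :
    (multiplet p j m * multiplet p l n).trace = 0 := by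
  by_cases hmn : m + n = 0
  · rw [trace_multiplet_mul]
    obtain ⟨r, hr⟩ : ∃ r, ((j : ℤ) - m).toNat + ((l : ℤ) - n).toNat = r + (2 * l + 1) :=
      ⟨((j : ℤ) - m).toNat + ((l : ℤ) - n).toNat - (2 * l + 1), by omega⟩
    rw [hr, Function.iterate_add_apply, (adMinus_iterate_highest p l).2,
      Function.iterate_fixed (adMinus_zero p)]
    simp
  · exact trace_multiplet_mul_of_add_ne_zero p j l m n hm hn hmn

lemma trace_multiplet_mul_of_ne (p j l : ℕ) (m n : ℤ) (hm : m ≤ j) (hn : n ≤ l)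
    (h : j ≠ l ∨ m + n ≠ 0) : (multiplet p j m * multiplet p l n).trace = 0 := by
  by_cases hmn : m + n = 0
  · rcases lt_or_gt_of_ne (h.resolve_right (not_not.mpr hmn)) with h | h
    · rw [trace_mul_comm]
      exact trace_multiplet_mul_of_lt p l j n m hn hm h
    · exact trace_multiplet_mul_of_lt p j l m n hm hn h
  · exact trace_multiplet_mul_of_add_ne_zero p j l m n hm hn hmn

lemma trace_multiplet_mul_neg_ne_zero (p j : ℕ) (hj : j < p) (m : ℤ) (hm : m ≤ j) (hm' : -j ≤ m) :
    (multiplet p j m * multiplet p j (-m)).trace ≠ 0 := by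
  rw [trace_multiplet_mul, show ((j : ℤ) - m).toNat + ((j : ℤ) - -m).toNat = 2 * j by omega]
  obtain ⟨c, hc, h⟩ := (adMinus_iterate_highest p j).1
  rw [h, Matrix.mul_smul, trace_smul]
  exact mul_ne_zero (pow_ne_zero _ (by norm_num))
    (mul_ne_zero hc (trace_highest_mul_eMinus_pow_ne_zero p j hj))

/-- Labels `(j, m)` with `0 ≤ j < p` and `-j ≤ m ≤ j`. -/
abbrev MultipletIndex (p : ℕ) : Type := (j : Fin p) × Finset.Icc (-((j : ℕ) : ℤ)) ((j : ℕ) : ℤ)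

lemma card_multipletIndex (p : ℕ) :
    Fintype.card (Fin p × Fin p) = Fintype.card (MultipletIndex p) := by
  simp only [Fintype.card_prod, Fintype.card_fin, Fintype.card_sigma, Fintype.card_coe,
    Int.card_Icc]
  have : ∀ j : Fin p, ((j : ℤ) + 1 - -(j : ℤ)).toNat = 2 * (j : ℕ) + 1 := fun j => by omega
  simp only [this]
  rw [Fin.sum_univ_eq_sum_range (fun j => 2 * j + 1)]
  clear this
  induction p with
  | zero => simp
  | succ p ih => rw [Finset.sum_range_succ, ← ih]; ring

/-- Completeness of the M_{j,m}: orthogonality gives a left inverse of the matrix of their entries,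
and ∑ (2j + 1) = p² makes it a right inverse too. -/
lemma sum_multiplet_mul (p : ℕ) (k l k' l' : Fin p) :
    ∑ i : MultipletIndex p, multiplet p i.1 i.2 k l *
      ((multiplet p i.1 i.2 * multiplet p i.1 (-i.2)).trace⁻¹ * multiplet p i.1 (-i.2) l' k') =
      if k = k' ∧ l = l' then 1 else 0 := by
  let A : Matrix (Fin p × Fin p) (MultipletIndex p) ℂ :=
    of fun x i => multiplet p i.1 i.2 x.1 x.2
  let B : Matrix (MultipletIndex p) (Fin p × Fin p) ℂ :=
    of fun i x => (multiplet p i.1 i.2 * multiplet p i.1 (-i.2)).trace⁻¹ *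
      multiplet p i.1 (-i.2) x.2 x.1
  have hBA : B * A = 1 := by
    ext ⟨i, m, hm⟩ ⟨j, n, hn⟩
    rw [Finset.mem_Icc] at hm hn
    have key : (B * A) ⟨i, m, Finset.mem_Icc.mpr hm⟩ ⟨j, n, Finset.mem_Icc.mpr hn⟩ =
        (multiplet p i m * multiplet p i (-m)).trace⁻¹ *
          (multiplet p i (-m) * multiplet p j n).trace := by
      rw [mul_apply, Fintype.sum_prod_type, Finset.sum_comm, trace.eq_1 (_ * multiplet p j n), Finset.mul_sum]
      refine Finset.sum_congr rfl fun x _ => ?_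
      rw [diag_apply, mul_apply, Finset.mul_sum]
      refine Finset.sum_congr rfl fun y _ => ?_
      simp only [A, B, of_apply]
      ring
    rw [key]
    by_cases h : i = j ∧ m = n
    · obtain ⟨rfl, rfl⟩ := h
      rw [one_apply_eq, trace_mul_comm (multiplet p i (-m)), inv_mul_cancel₀]
      exact trace_multiplet_mul_neg_ne_zero p i i.2 m hm.2 hm.1
    · rw [one_apply_ne, trace_multiplet_mul_of_ne _ _ _ _ _ (by omega) hn.2, mul_zero]
      · by_contra! h'
        exact h ⟨Fin.ext h'.1, by omega⟩
      · intro h'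
        simp only [Sigma.mk.injEq] at h'
        obtain ⟨rfl, h'⟩ := h'
        exact h ⟨rfl, congrArg Subtype.val (eq_of_heq h')⟩
  have hAB : A * B = 1 := (mul_eq_one_comm_of_card_eq _ _ _ (card_multipletIndex p).symm).mp hBA
  have := congrFun (congrFun hAB (k, l)) (k', l')
  rw [mul_apply, one_apply] at this
  simpa only [A, B, of_apply, Prod.mk.injEq] using this

end FiniteW

namespace FiniteW

open Matrix

/-! ### Biderivations -/

section Biderivation

variable {σ : Type} [Fintype σ] (π : σ → σ → MvPolynomial σ ℂ)

/-- A biderivation as a derivation in its second argument. -/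
noncomputable def biderivationRight (f : MvPolynomial σ ℂ) :
    Derivation ℂ (MvPolynomial σ ℂ) (MvPolynomial σ ℂ) :=
  ∑ k, (∑ i, MvPolynomial.pderiv i f * π i k) • MvPolynomial.pderiv k

/-- A biderivation as a derivation in its first argument. -/
noncomputable def biderivationLeft (g : MvPolynomial σ ℂ) :
    Derivation ℂ (MvPolynomial σ ℂ) (MvPolynomial σ ℂ) :=
  ∑ i, (∑ k, MvPolynomial.pderiv k g * π i k) • MvPolynomial.pderiv i

lemma derivation_sum_apply {A ι : Type*} [CommRing A] [Algebra ℂ A] (s : Finset ι)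
    (D : ι → Derivation ℂ A A) (a : A) : (∑ i ∈ s, D i) a = ∑ i ∈ s, D i a := by
  rw [← Derivation.coeFnAddMonoidHom_apply, map_sum, Finset.sum_apply]
  rfl

lemma derivation_C_mul {σ : Type} {D : Derivation ℂ (MvPolynomial σ ℂ) (MvPolynomial σ ℂ)} (c : ℂ)
    (f : MvPolynomial σ ℂ) : D (MvPolynomial.C c * f) = MvPolynomial.C c * D f := by
  rw [← MvPolynomial.smul_eq_C_mul, ← MvPolynomial.smul_eq_C_mul, Derivation.map_smul]

lemma biderivationRight_apply (f g : MvPolynomial σ ℂ) :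
    biderivationRight π f g = biderivation π f g := by
  rw [biderivationRight, biderivation, derivation_sum_apply, Finset.sum_comm]
  refine Finset.sum_congr rfl fun k _ => ?_
  rw [Derivation.smul_apply, smul_eq_mul, Finset.sum_mul]
  exact Finset.sum_congr rfl fun i _ => by ring

lemma biderivationLeft_apply (f g : MvPolynomial σ ℂ) :
    biderivationLeft π g f = biderivation π f g := by
  rw [biderivationLeft, biderivation, derivation_sum_apply]
  refine Finset.sum_congr rfl fun k _ => ?_
  rw [Derivation.smul_apply, smul_eq_mul, Finset.sum_mul]
  exact Finset.sum_congr rfl fun i _ => by ring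

lemma biderivation_X_left (i : σ) (g : MvPolynomial σ ℂ) :
    biderivation π (MvPolynomial.X i) g = ∑ k, MvPolynomial.pderiv k g * π i k := by
  classical
  rw [biderivation, Finset.sum_eq_single i]
  · simp
  · intro j _ hj
    simp [MvPolynomial.pderiv_X_of_ne hj.symm]
  · simp

lemma biderivation_X_right (f : MvPolynomial σ ℂ) (k : σ) :
    biderivation π f (MvPolynomial.X k) = ∑ i, MvPolynomial.pderiv i f * π i k := by
  classical
  rw [biderivation]
  refine Finset.sum_congr rfl fun i _ => ?_
  rw [Finset.sum_eq_single k]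
  · simp
  · intro j _ hj
    simp [MvPolynomial.pderiv_X_of_ne hj.symm]
  · simp

lemma biderivation_X_X (i k : σ) :
    biderivation π (MvPolynomial.X i) (MvPolynomial.X k) = π i k := by
  classical
  rw [biderivation_X_left, Finset.sum_eq_single k]
  · simp
  · intro j _ hj
    simp [MvPolynomial.pderiv_X_of_ne hj.symm]
  · simp

lemma biderivation_eq_sum_left (f g : MvPolynomial σ ℂ) :
    biderivation π f g =
      ∑ i, MvPolynomial.pderiv i f * biderivation π (MvPolynomial.X i) g := by
  simp only [biderivation_X_left, Finset.mul_sum]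
  rw [biderivation]
  exact Finset.sum_congr rfl fun k _ => Finset.sum_congr rfl fun i _ => mul_assoc _ _ _

lemma biderivation_eq_sum_right (f g : MvPolynomial σ ℂ) :
    biderivation π f g =
      ∑ k, MvPolynomial.pderiv k g * biderivation π f (MvPolynomial.X k) := by
  simp only [biderivation_X_right, Finset.mul_sum]
  rw [biderivation, Finset.sum_comm]
  exact Finset.sum_congr rfl fun k _ => Finset.sum_congr rfl fun i _ => by ring

lemma biderivation_antisymm (hπ : ∀ i k, π i k = -π k i) (f g : MvPolynomial σ ℂ) :
    biderivation π f g = -biderivation π g f := by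
  rw [biderivation, biderivation, Finset.sum_comm, ← Finset.sum_neg_distrib]
  refine Finset.sum_congr rfl fun k _ => ?_
  rw [← Finset.sum_neg_distrib]
  refine Finset.sum_congr rfl fun i _ => ?_
  rw [hπ]; ring

end Biderivation

lemma pderiv_aeval {σ τ : Type} [Fintype σ] (φ : σ → MvPolynomial τ ℂ)
    (i : τ) (f : MvPolynomial σ ℂ) :
    MvPolynomial.pderiv i (MvPolynomial.aeval φ f) =
      ∑ x, MvPolynomial.aeval φ (MvPolynomial.pderiv x f) * MvPolynomial.pderiv i (φ x) := by
  classical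
  induction f using MvPolynomial.induction_on with
  | C a => simp [MvPolynomial.algebraMap_eq]
  | add f g hf hg => simp only [map_add, hf, hg, add_mul, Finset.sum_add_distrib]
  | mul_X f k hf =>
    simp only [map_mul, Derivation.leibniz, hf, MvPolynomial.aeval_X, smul_eq_mul, map_add,
      add_mul, Finset.sum_add_distrib, Finset.mul_sum]
    congr 1
    · rw [Finset.sum_eq_single k]
      · simp
      · intro j _ hj
        simp [MvPolynomial.pderiv_X_of_ne hj.symm]
      · simp
    · exact Finset.sum_congr rfl fun x _ => by ring

/-! ### The Poisson bracket of `gl(Np)` -/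

variable (N p : ℕ)

lemma glBracket_eq_biderivation : glBracket N p = biderivation fun x y =>
    (if x.2 = y.1 then genericMatrix N p x.1 y.2 else 0) -
      (if x.1 = y.2 then genericMatrix N p y.1 x.2 else 0) := rfl

lemma exists_derivation_glBracket_right (f : Amb N p) :
    ∃ D : Derivation ℂ (Amb N p) (Amb N p), ∀ g, glBracket N p f g = D g :=
  ⟨_, fun g => (biderivationRight_apply _ f g).symm⟩

lemma exists_derivation_glBracket_left (g : Amb N p) :
    ∃ D : Derivation ℂ (Amb N p) (Amb N p), ∀ f, glBracket N p f g = D f :=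
  ⟨_, fun f => (biderivationLeft_apply _ f g).symm⟩

lemma glBracket_X_X (A B C D : Fin N × Fin p) :
    glBracket N p (MvPolynomial.X (A, B)) (MvPolynomial.X (C, D)) =
      (if B = C then MvPolynomial.X (A, D) else 0) -
        (if A = D then MvPolynomial.X (C, B) else 0) := by
  rw [glBracket_eq_biderivation, biderivation_X_X]
  rfl

lemma glBracket_antisymm (f g : Amb N p) : glBracket N p f g = -glBracket N p g f := by
  refine biderivation_antisymm _ (fun x y => ?_) f g
  simp only [neg_sub, eq_comm]

/-- `tr_p (M J^{ab})` for the block `J^{ab}` of the generic matrix. -/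
noncomputable def blockForm (M : Matrix (Fin p) (Fin p) ℂ) (a b : Fin N) : Amb N p :=
  ∑ k, ∑ l, MvPolynomial.C (M l k) * MvPolynomial.X ((a, k), (b, l))

variable {N p}

lemma coord_eq (j : ℕ) (m : ℤ) (a b : Fin N) :
    coord N p j m a b = MvPolynomial.C ((multiplet p j m * multiplet p j (-m)).trace)⁻¹ *
      blockForm N p (multiplet p j (-m)) a b := by
  rw [coord]
  congr 1
  rw [trace, blockForm, Fintype.sum_prod_type, Finset.sum_eq_single b]
  · simp only [diag_apply, mul_apply, Fintype.sum_prod_type]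
    rw [Finset.sum_comm, Finset.sum_eq_single a]
    · rw [Finset.sum_comm]
      refine Finset.sum_congr rfl fun k _ => Finset.sum_congr rfl fun l _ => ?_
      simp [glBasis, genericMatrix, kroneckerMap_apply]
    · intro c _ hc
      refine Finset.sum_eq_zero fun k _ => Finset.sum_eq_zero fun l _ => ?_
      simp [glBasis, kroneckerMap_apply, hc.symm]
    · simp
  · intro c _ hc
    refine Finset.sum_eq_zero fun k _ => ?_
    rw [diag_apply, mul_apply]
    refine Finset.sum_eq_zero fun l _ => ?_
    simp [glBasis, kroneckerMap_apply, hc.symm]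
  · simp

lemma glBracket_blockForm_left (M : Matrix (Fin p) (Fin p) ℂ) (a b : Fin N) (g : Amb N p) :
    glBracket N p (blockForm N p M a b) g =
      ∑ k, ∑ l, MvPolynomial.C (M l k) * glBracket N p (MvPolynomial.X ((a, k), (b, l))) g := by
  obtain ⟨D, hD⟩ := exists_derivation_glBracket_left N p g
  simp only [hD, blockForm, map_sum, derivation_C_mul]

lemma glBracket_C_mul_left (c : ℂ) (f g : Amb N p) :
    glBracket N p (MvPolynomial.C c * f) g = MvPolynomial.C c * glBracket N p f g := by
  obtain ⟨D, hD⟩ := exists_derivation_glBracket_left N p g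
  simp only [hD, derivation_C_mul]

lemma glBracket_C_mul_right (c : ℂ) (f g : Amb N p) :
    glBracket N p f (MvPolynomial.C c * g) = MvPolynomial.C c * glBracket N p f g := by
  obtain ⟨D, hD⟩ := exists_derivation_glBracket_right N p f
  simp only [hD, derivation_C_mul]

lemma glBracket_blockForm (M M' : Matrix (Fin p) (Fin p) ℂ) (a b c d : Fin N) :
    glBracket N p (blockForm N p M a b) (blockForm N p M' c d) =
      (if b = c then blockForm N p (M' * M) a d else 0) -
        (if a = d then blockForm N p (M * M') c b else 0) := by
  have h1 : ∀ k l, glBracket N p (MvPolynomial.X ((a, k), (b, l))) (blockForm N p M' c d) =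
      (if b = c then ∑ l', MvPolynomial.C (M' l' l) * MvPolynomial.X ((a, k), (d, l')) else 0) -
      (if a = d then ∑ k', MvPolynomial.C (M' k k') * MvPolynomial.X ((c, k'), (b, l)) else 0) := by
    intro k l
    obtain ⟨D, hD⟩ := exists_derivation_glBracket_right N p (MvPolynomial.X ((a, k), (b, l)))
    simp only [hD, blockForm, map_sum, derivation_C_mul]
    simp only [← hD, glBracket_X_X, Prod.mk.injEq, mul_sub, Finset.sum_sub_distrib]
    congr 1
    · split_ifs with h
      · rw [Finset.sum_comm]
        exact Finset.sum_congr rfl fun l' _ => by simp [h]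
      · simp [h]
    · split_ifs with h
      · exact Finset.sum_congr rfl fun l' _ => by simp [h]
      · simp [h]
  rw [glBracket_blockForm_left]
  simp only [h1, mul_sub, Finset.sum_sub_distrib]
  congr 1
  · split_ifs
    · simp only [blockForm, mul_apply, map_sum, Finset.sum_mul, Finset.mul_sum, map_mul]
      refine Finset.sum_congr rfl fun k _ => ?_
      rw [Finset.sum_comm]
      exact Finset.sum_congr rfl fun _ _ => Finset.sum_congr rfl fun _ _ => by ring
    · simp
  · split_ifs
    · simp only [blockForm, mul_apply, map_sum, Finset.sum_mul, Finset.mul_sum, map_mul]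
      refine Finset.sum_comm.trans (Eq.trans ?_ Finset.sum_comm)
      refine Finset.sum_congr rfl fun _ _ => Finset.sum_comm.trans ?_
      exact Finset.sum_congr rfl fun _ _ => Finset.sum_congr rfl fun _ _ => by ring
    · simp

lemma X_eq_sum_coord (x : (Fin N × Fin p) × (Fin N × Fin p)) :
    (MvPolynomial.X x : Amb N p) = ∑ i : MultipletIndex p, ∑ a, ∑ b,
      MvPolynomial.C (glBasis N p i.1 i.2 a b x.1 x.2) * coord N p i.1 i.2 a b := by
  obtain ⟨⟨a₀, k⟩, ⟨b₀, l⟩⟩ := x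
  have h1 : ∀ i : MultipletIndex p, (∑ a, ∑ b,
      MvPolynomial.C (glBasis N p i.1 i.2 a b (a₀, k) (b₀, l)) * coord N p i.1 i.2 a b) =
      MvPolynomial.C (multiplet p i.1 i.2 k l) * coord N p i.1 i.2 a₀ b₀ := by
    intro i
    rw [Finset.sum_eq_single a₀, Finset.sum_eq_single b₀]
    · simp [glBasis, kroneckerMap_apply]
    · intro b _ hb
      simp [glBasis, kroneckerMap_apply, hb]
    · simp
    · intro a _ ha
      refine Finset.sum_eq_zero fun b _ => ?_
      simp [glBasis, kroneckerMap_apply, ha]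
    · simp
  rw [Finset.sum_congr rfl fun i _ => h1 i]
  simp only [coord_eq, blockForm, Finset.mul_sum]
  rw [Finset.sum_comm]
  have h2 : ∀ k', (∑ i : MultipletIndex p, ∑ l', MvPolynomial.C (multiplet p i.1 i.2 k l) *
      (MvPolynomial.C ((multiplet p i.1 i.2 * multiplet p i.1 (-i.2)).trace)⁻¹ *
        (MvPolynomial.C (multiplet p i.1 (-i.2) l' k') * MvPolynomial.X ((a₀, k'), (b₀, l'))))) =
      ∑ l', (if k = k' ∧ l = l' then (MvPolynomial.X ((a₀, k'), (b₀, l')) : Amb N p) else 0) := by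
    intro k'
    rw [Finset.sum_comm]
    refine Finset.sum_congr rfl fun l' _ => ?_
    have := congrArg (MvPolynomial.C (σ := (Fin N × Fin p) × (Fin N × Fin p)))
      (sum_multiplet_mul p k l k' l')
    rw [map_sum] at this
    calc _ = (∑ i : MultipletIndex p, MvPolynomial.C (multiplet p i.1 i.2 k l *
              ((multiplet p i.1 i.2 * multiplet p i.1 (-i.2)).trace⁻¹ *
                multiplet p i.1 (-i.2) l' k'))) * MvPolynomial.X ((a₀, k'), (b₀, l')) := by
            rw [Finset.sum_mul]
            exact Finset.sum_congr rfl fun i _ => by simp only [map_mul, mul_assoc]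
      _ = _ := by
            rw [this]
            split_ifs <;> simp
  rw [Finset.sum_congr rfl fun k' _ => h2 k', Finset.sum_eq_single k, Finset.sum_eq_single l]
  · simp
  · intro l' _ hl
    simp [hl.symm]
  · simp
  · intro k' _ hk
    simp [hk.symm]
  · simp

end FiniteW

namespace FiniteW

open Matrix

variable {N p : ℕ}

/-! ### Gauge fixed matrices -/

lemma gaugeFixed_apply (a b : Fin N) (k l : Fin p) :
    gaugeFixed N p (a, k) (b, l) = MvPolynomial.C (if a = b then eMinus p k l else 0) +
      if (k : ℕ) ≤ l then MvPolynomial.C (highest p (l - k) k l) * W N p (l - k) a b else 0 := by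
  rw [gaugeFixed, Matrix.add_apply]
  congr 1
  · simp [epsMinus, kroneckerMap_apply, one_apply]
  · simp only [Matrix.sum_apply, Matrix.smul_apply]
    have h1 : ∀ j : Fin p, (∑ a', ∑ b', W N p j a' b' •
        (glBasis N p j (j : ℕ) a' b').map MvPolynomial.C (a, k) (b, l)) =
        W N p j a b * MvPolynomial.C (highest p j k l) := by
      intro j
      rw [Finset.sum_eq_single a, Finset.sum_eq_single b]
      · simp [glBasis, kroneckerMap_apply, multiplet_self]
      · intro c _ hc
        simp [glBasis, kroneckerMap_apply, hc]
      · simp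
      · intro c _ hc
        refine Finset.sum_eq_zero fun d _ => ?_
        simp [glBasis, kroneckerMap_apply, hc]
      · simp
    rw [Finset.sum_congr rfl fun j _ => h1 j]
    split_ifs with h
    · rw [Finset.sum_eq_single (⟨l - k, by omega⟩ : Fin p)]
      · rw [mul_comm]
      · intro j _ hj
        rw [highest_apply_of_ne, map_zero, mul_zero]
        intro h'
        exact hj (Fin.ext (by simp; omega))
      · simp
    · refine Finset.sum_eq_zero fun j _ => ?_
      rw [highest_apply_of_ne (by omega), map_zero, mul_zero]

lemma impose_X (x : (Fin N × Fin p) × (Fin N × Fin p)) :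
    impose N p (MvPolynomial.X x) = gaugeFixed N p x.1 x.2 := by
  simp [impose]

lemma impose_C (c : ℂ) : impose N p (MvPolynomial.C c) = MvPolynomial.C c := by
  simp [impose, MvPolynomial.algebraMap_eq]

lemma impose_blockForm (M : Matrix (Fin p) (Fin p) ℂ) (a b : Fin N) :
    impose N p (blockForm N p M a b) =
      ∑ k, ∑ l, MvPolynomial.C (M l k) * gaugeFixed N p (a, k) (b, l) := by
  simp only [blockForm, map_sum, map_mul, impose_X, impose_C]

/-- Only entries with k - l = d are met; for d > 1 they lie below the diagonal of e₋ and vanish on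
the slice. -/
lemma impose_blockForm_of_one_lt {M : Matrix (Fin p) (Fin p) ℂ} {d : ℤ}
    (hM : ∀ l k : Fin p, (k : ℤ) - l ≠ d → M l k = 0) (hd : 1 < d) (a b : Fin N) :
    impose N p (blockForm N p M a b) = 0 := by
  rw [impose_blockForm]
  refine Finset.sum_eq_zero fun k _ => Finset.sum_eq_zero fun l _ => ?_
  by_cases h : (k : ℤ) - l = d
  · rw [gaugeFixed_apply, eMinus_apply, if_neg (by omega : ¬ (k : ℕ) = l + 1),
      if_neg (by omega : ¬ (k : ℕ) ≤ l)]
    simp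
  · rw [hM l k h]; simp

/-- In degree one only the entries of e₋ are met, so no W occurs. This is why the antidiagonal
blocks of Δ are constant and its determinant can be a unit of the polynomial ring. -/
lemma impose_blockForm_of_eq_one {M : Matrix (Fin p) (Fin p) ℂ}
    (hM : ∀ l k : Fin p, (k : ℤ) - l ≠ 1 → M l k = 0) (a b : Fin N) :
    impose N p (blockForm N p M a b) =
      MvPolynomial.C (if a = b then (M * eMinus p).trace else 0) := by
  have h1 : ∀ k l, MvPolynomial.C (M l k) * gaugeFixed N p (a, k) (b, l) =
      MvPolynomial.C (if a = b then M l k * eMinus p k l else 0) := by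
    intro k l
    by_cases h : (k : ℤ) - l = 1
    · rw [gaugeFixed_apply, if_neg (by omega : ¬ ((k : ℕ) ≤ l)), add_zero, ← map_mul]
      simp
    · rw [hM l k h]; simp
  rw [impose_blockForm]
  simp only [h1, ← map_sum]
  congr 1
  split_ifs
  · simp only [trace, diag_apply, mul_apply]
    rw [Finset.sum_comm]
  · simp

lemma multiplet_mul_apply_eq_zero {j i : ℕ} {m n : ℤ} (hm : m ≤ j) (hn : n ≤ i) (k l : Fin p)
    (h : (l : ℤ) - k ≠ m + n) : (multiplet p j m * multiplet p i n) k l = 0 := by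
  rw [mul_apply]
  refine Finset.sum_eq_zero fun x _ => ?_
  by_cases hx : (x : ℤ) - k = m
  · rw [multiplet_apply_eq_zero p i n hn _ _ (by omega), mul_zero]
  · rw [multiplet_apply_eq_zero p j m hm _ _ hx, zero_mul]

/-! ### Evaluation of brackets in terms of gradients -/

lemma impose_glBracket_eq_sum_left (f g : Amb N p) : impose N p (glBracket N p f g) =
    ∑ x, impose N p (MvPolynomial.pderiv x f) *
      impose N p (glBracket N p (MvPolynomial.X x) g) := by
  rw [glBracket_eq_biderivation, biderivation_eq_sum_left, map_sum]
  simp only [map_mul]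

lemma impose_glBracket_eq_sum_right (f g : Amb N p) : impose N p (glBracket N p f g) =
    ∑ x, impose N p (MvPolynomial.pderiv x g) *
      impose N p (glBracket N p f (MvPolynomial.X x)) := by
  rw [glBracket_eq_biderivation, biderivation_eq_sum_right, map_sum]
  simp only [map_mul]

/-- Every bracket is a first order operator in `f`, so only the gradient of `f` on the slice enters.
-/
lemma diracBracket_eq_sum_left (f g : Amb N p) : diracBracket N p f g =
    ∑ x, impose N p (MvPolynomial.pderiv x f) * diracBracket N p (MvPolynomial.X x) g := by
  simp only [diracBracket, mul_sub, Finset.sum_sub_distrib]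
  rw [impose_glBracket_eq_sum_left]
  congr 1
  simp only [Finset.mul_sum]
  rw [Finset.sum_comm (s := (Finset.univ : Finset ((Fin N × Fin p) × (Fin N × Fin p))))]
  refine Finset.sum_congr rfl fun α _ => ?_
  rw [Finset.sum_comm (s := (Finset.univ : Finset ((Fin N × Fin p) × (Fin N × Fin p))))]
  refine Finset.sum_congr rfl fun β _ => ?_
  rw [impose_glBracket_eq_sum_left f, Finset.sum_mul, Finset.sum_mul]
  exact Finset.sum_congr rfl fun x _ => by ring

lemma diracBracket_eq_sum_right (f g : Amb N p) : diracBracket N p f g =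
    ∑ x, impose N p (MvPolynomial.pderiv x g) * diracBracket N p f (MvPolynomial.X x) := by
  simp only [diracBracket, mul_sub, Finset.sum_sub_distrib]
  rw [impose_glBracket_eq_sum_right]
  congr 1
  simp only [Finset.mul_sum]
  rw [Finset.sum_comm (s := (Finset.univ : Finset ((Fin N × Fin p) × (Fin N × Fin p))))]
  refine Finset.sum_congr rfl fun α _ => ?_
  rw [Finset.sum_comm (s := (Finset.univ : Finset ((Fin N × Fin p) × (Fin N × Fin p))))]
  refine Finset.sum_congr rfl fun β _ => ?_
  rw [impose_glBracket_eq_sum_right _ g, Finset.mul_sum]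
  exact Finset.sum_congr rfl fun x _ => by ring

/-! ### The matrix of constraints -/

lemma glBracket_constraint_left (α : ConstraintIndex N p) (g : Amb N p) :
    glBracket N p (constraint N p α) g =
      glBracket N p (coord N p α.1.1 α.1.2 α.2.1 α.2.2) g := by
  obtain ⟨D, hD⟩ := exists_derivation_glBracket_left N p g
  rw [hD, hD, constraint, map_sub, MvPolynomial.derivation_C, sub_zero]

lemma glBracket_constraint_right (f : Amb N p) (α : ConstraintIndex N p) :
    glBracket N p f (constraint N p α) =
      glBracket N p f (coord N p α.1.1 α.1.2 α.2.1 α.2.2) := by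
  obtain ⟨D, hD⟩ := exists_derivation_glBracket_right N p f
  rw [hD, hD, constraint, map_sub, MvPolynomial.derivation_C, sub_zero]

/-- The nonzero normalisation `tr(M_{j,m} M_{j,-m})`. -/
noncomputable def pairing (p j : ℕ) (m : ℤ) : ℂ :=
  (multiplet p j m * multiplet p j (-m)).trace

lemma glBracket_coord (j i : ℕ) (m n : ℤ) (a b c d : Fin N) :
    glBracket N p (coord N p j m a b) (coord N p i n c d) =
      MvPolynomial.C (pairing p j m)⁻¹ * (MvPolynomial.C (pairing p i n)⁻¹ *
      ((if b = c then blockForm N p (multiplet p i (-n) * multiplet p j (-m)) a d else 0) -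
        (if a = d then blockForm N p (multiplet p j (-m) * multiplet p i (-n)) c b else 0))) := by
  rw [coord_eq, coord_eq, glBracket_C_mul_left, glBracket_C_mul_right, glBracket_blockForm]
  rfl

lemma impose_glBracket_coord_of_lt {j i : ℕ} {m n : ℤ} (hm : -m ≤ j) (hn : -n ≤ i)
    (h : n < -1 - m) (a b c d : Fin N) :
    impose N p (glBracket N p (coord N p j m a b) (coord N p i n c d)) = 0 := by
  rw [glBracket_coord]
  simp only [map_mul, map_sub, apply_ite (impose N p), map_zero]
  rw [impose_blockForm_of_one_lt (d := -n + -m)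
      (fun (l k : Fin p) hlk => multiplet_mul_apply_eq_zero hn hm l k hlk) (by omega),
    impose_blockForm_of_one_lt (d := -m + -n)
      (fun (l k : Fin p) hlk => multiplet_mul_apply_eq_zero hm hn l k hlk) (by omega)]
  simp

lemma impose_glBracket_coord_of_eq {j i : ℕ} {m n : ℤ} (hm : -m ≤ j) (hn : -n ≤ i)
    (h : n = -1 - m) (a b c d : Fin N) :
    impose N p (glBracket N p (coord N p j m a b) (coord N p i n c d)) =
      if b = c ∧ a = d then MvPolynomial.C (-((pairing p j m)⁻¹ * (pairing p i n)⁻¹ *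
        (multiplet p i (-n) * multiplet p j n).trace)) else 0 := by
  -- Cyclicity of the trace assembles the two terms into a pairing with -[e₋, M_{j,-m}], and the
  -- lowered weight -m - 1 is n.
  have htr : ((multiplet p i (-n) * multiplet p j (-m)) * eMinus p).trace -
      ((multiplet p j (-m) * multiplet p i (-n)) * eMinus p).trace =
      -(multiplet p i (-n) * multiplet p j n).trace := by
    have h1 : n = -m - 1 := by omega
    have h2 := adMinus_multiplet p j (-m) hm
    rw [← h1] at h2
    rw [← h2, adMinus, mul_sub, trace_sub, neg_sub, mul_assoc]
    congr 1
    rw [mul_assoc, trace_mul_comm, mul_assoc]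
  rw [glBracket_coord]
  simp only [map_mul, map_sub, apply_ite (impose N p), map_zero, impose_C]
  rw [impose_blockForm_of_eq_one
      (fun (l k : Fin p) hlk => multiplet_mul_apply_eq_zero hn hm l k (by omega)),
    impose_blockForm_of_eq_one
      (fun (l k : Fin p) hlk => multiplet_mul_apply_eq_zero hm hn l k (by omega))]
  by_cases hbc : b = c <;> by_cases had : a = d
  · simp only [hbc, had, if_true, and_self, ← map_sub, htr, ← map_mul]
    congr 1
    ring
  all_goals simp [hbc, had, eq_comm]

/-- The map `(j, m, a, b) ↦ (j, -1 - m, b, a)` on the labels of the constraints. -/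
def swapConstraint (α : ConstraintIndex N p) : ConstraintIndex N p :=
  (⟨α.1.1, ⟨-1 - α.1.2, by
      have := Finset.mem_Ico.mp α.1.2.2
      exact Finset.mem_Ico.mpr ⟨by omega, by omega⟩⟩⟩, α.2.2, α.2.1)

lemma swapConstraint_swapConstraint (α : ConstraintIndex N p) :
    swapConstraint (swapConstraint α) = α := by
  simp [swapConstraint]

/-- The involution `(j, m, a, b) ↦ (j, -1 - m, b, a)` of the labels of the constraints. -/
def constraintSwap (N p : ℕ) : Equiv.Perm (ConstraintIndex N p) :=
  Function.Involutive.toPerm swapConstraint swapConstraint_swapConstraint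

lemma constraintSwap_apply (α : ConstraintIndex N p) :
    constraintSwap N p α = swapConstraint α := rfl

/-- The weight of a constraint. -/
def constraintWeight (α : ConstraintIndex N p) : ℤ := -α.1.2

/-- The involution m ↦ -1 - m on columns turns the vanishing of Δ for m_α + m_β < -1 into
triangularity. -/
lemma blockTriangular_diracMatrix :
    BlockTriangular ((diracMatrix N p).submatrix id (constraintSwap N p)) constraintWeight := by
  rintro ⟨⟨j, m, hm⟩, a, b⟩ ⟨⟨i, n, hn⟩, c, d⟩ h
  rw [Finset.mem_Ico] at hm hn
  simp only [constraintWeight] at h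
  simp only [submatrix_apply, id, diracMatrix, of_apply, glBracket_constraint_left,
    glBracket_constraint_right, constraintSwap_apply, swapConstraint]
  exact impose_glBracket_coord_of_lt (by omega) (by omega) (by omega) _ _ _ _

lemma isUnit_det_diracMatrix : IsUnit (diracMatrix N p).det := by
  have h := det_permute' (constraintSwap N p) (diracMatrix N p)
  suffices h' : IsUnit ((diracMatrix N p).submatrix id (constraintSwap N p)).det by
    rw [h] at h'
    exact isUnit_of_mul_isUnit_right h'
  rw [blockTriangular_diracMatrix.det]
  refine Finset.prod_induction _ IsUnit (fun _ _ => IsUnit.mul) isUnit_one fun w _ => ?_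
  -- The diagonal blocks pair weights m and -1 - m. Orthogonality of different multiplets makes them
  -- diagonal, with nonzero constants as entries.
  have hd : ((diracMatrix N p).submatrix id (constraintSwap N p)).toSquareBlock
      constraintWeight w = diagonal fun α => MvPolynomial.C
        (-((pairing p α.1.1.1 α.1.1.2)⁻¹ * (pairing p α.1.1.1 (-1 - α.1.1.2))⁻¹ *
        (multiplet p α.1.1.1 (-(-1 - α.1.1.2)) * multiplet p α.1.1.1 (-1 - α.1.1.2)).trace)) := by
    ext1 ⟨⟨⟨j, m, hm⟩, a, b⟩, hα⟩ ⟨⟨⟨i, n, hn⟩, c, d⟩, hβ⟩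
    simp only [constraintWeight] at hα hβ
    obtain rfl : m = n := by omega
    rw [Finset.mem_Ico] at hm hn
    simp only [toSquareBlock_def, submatrix_apply, id, diracMatrix, of_apply,
      glBracket_constraint_left, glBracket_constraint_right, constraintSwap_apply, swapConstraint]
    rw [impose_glBracket_coord_of_eq (by omega) (by omega) rfl]
    by_cases hab : b = d ∧ a = c
    · obtain ⟨rfl, rfl⟩ := hab
      by_cases hji : j = i
      · subst hji
        simp
      · rw [diagonal_apply_ne _ (fun h => by cases h; exact hji rfl), if_pos ⟨rfl, rfl⟩,
          trace_multiplet_mul_of_ne _ _ _ _ _ (by omega) (by omega)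
            (Or.inl (fun h => hji (Fin.ext h.symm)))]
        simp
    · rw [if_neg hab, diagonal_apply_ne]
      rintro ⟨⟩
      exact hab ⟨rfl, rfl⟩
  rw [hd, det_diagonal]
  refine Finset.prod_induction _ IsUnit (fun _ _ => IsUnit.mul) isUnit_one ?_
  rintro ⟨⟨⟨j, m, hm⟩, a, b⟩, hα⟩ -
  rw [Finset.mem_Ico] at hm
  refine (IsUnit.mk0 _ ?_).map _
  refine neg_ne_zero.mpr (mul_ne_zero (mul_ne_zero (inv_ne_zero ?_) (inv_ne_zero ?_)) ?_)
  · exact trace_multiplet_mul_neg_ne_zero p j j.2 m (by omega) (by omega)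
  · exact trace_multiplet_mul_neg_ne_zero p j j.2 _ (by simp; omega) (by simp; omega)
  · have := trace_multiplet_mul_neg_ne_zero p j j.2 (-(-1 - m)) (by omega) (by omega)
    rwa [neg_neg] at this

/-- The inverse of a block triangular matrix is block triangular. Once the swap is undone, the entry
(α, β) compares the weights 1 + m_α > 0 and -m_β ≤ 0, so it lies in the zero part. -/
lemma inv_diracMatrix_apply_eq_zero (α β : ConstraintIndex N p) (hα : 0 ≤ (α.1.2 : ℤ))
    (hβ : 0 ≤ (β.1.2 : ℤ)) : (diracMatrix N p)⁻¹ α β = 0 := by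
  have hu : IsUnit ((diracMatrix N p).submatrix id (constraintSwap N p)) := by
    have : IsUnit (diracMatrix N p) := (isUnit_iff_isUnit_det _).mpr isUnit_det_diracMatrix
    exact (isUnit_submatrix_equiv (Equiv.refl _) (constraintSwap N p)).mpr this
  let _ := hu.invertible
  have h := blockTriangular_inv_of_blockTriangular (blockTriangular_diracMatrix (N := N) (p := p))
  have h2 : ((diracMatrix N p).submatrix id (constraintSwap N p))⁻¹ =
      (diracMatrix N p)⁻¹.submatrix (constraintSwap N p) id :=
    inv_submatrix_equiv (diracMatrix N p) (Equiv.refl _) (constraintSwap N p)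
  rw [h2] at h
  have h3 := @h (constraintSwap N p α) β (by
    simp only [constraintWeight, constraintSwap_apply, swapConstraint]
    omega)
  rwa [submatrix_apply, id, constraintSwap_apply, constraintSwap_apply,
    swapConstraint_swapConstraint] at h3

/-! ### Properties of the Dirac bracket -/

/-- Because ΔΔ⁻¹ = 1, the correction reproduces the bracket itself: constraints are Casimirs of the
Dirac bracket. -/
lemma diracBracket_constraint_left (α : ConstraintIndex N p) (g : Amb N p) :
    diracBracket N p (constraint N p α) g = 0 := by
  rw [diracBracket, Finset.sum_comm, sub_eq_zero]
  have h := mul_nonsing_inv (diracMatrix N p) isUnit_det_diracMatrix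
  have h1 : ∀ β, ∑ γ, impose N p (glBracket N p (constraint N p α) (constraint N p γ)) *
      (diracMatrix N p)⁻¹ γ β = if α = β then 1 else 0 := by
    intro β
    rw [← one_apply, ← h, mul_apply]
    rfl
  simp only [← Finset.sum_mul, h1]
  simp

lemma diracBracket_constraint_right (f : Amb N p) (α : ConstraintIndex N p) :
    diracBracket N p f (constraint N p α) = 0 := by
  rw [diracBracket, sub_eq_zero]
  have h := nonsing_inv_mul (diracMatrix N p) isUnit_det_diracMatrix
  have h1 : ∀ β, ∑ γ, (diracMatrix N p)⁻¹ β γ *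
      impose N p (glBracket N p (constraint N p γ) (constraint N p α)) =
        if β = α then 1 else 0 := by
    intro β
    rw [← one_apply, ← h, mul_apply]
    rfl
  simp only [mul_assoc, ← Finset.mul_sum, h1]
  simp

lemma diracBracket_coord_left (j : Fin p) (m : ℤ) (hm : -j ≤ m) (hm' : m < j) (a b : Fin N)
    (g : Amb N p) : diracBracket N p (coord N p j m a b) g = 0 := by
  have h := diracBracket_constraint_left (N := N) (p := p)
    (⟨j, m, Finset.mem_Ico.mpr ⟨hm, hm'⟩⟩, a, b) g
  rw [diracBracket_eq_sum_left] at h ⊢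
  simpa [constraint] using h

lemma diracBracket_coord_right (j : Fin p) (m : ℤ) (hm : -j ≤ m) (hm' : m < j) (a b : Fin N)
    (f : Amb N p) : diracBracket N p f (coord N p j m a b) = 0 := by
  have h := diracBracket_constraint_right (N := N) (p := p) f
    (⟨j, m, Finset.mem_Ico.mpr ⟨hm, hm'⟩⟩, a, b)
  rw [diracBracket_eq_sum_right] at h ⊢
  simpa [constraint] using h

/-- Each correction term has a vanishing factor: the first if m_α < 0, the last if m_β < 0, and the
entry of Δ⁻¹ otherwise. -/
lemma diracBracket_of_commute (f g : Amb N p)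
    (hf : ∀ α : ConstraintIndex N p, (α.1.2 : ℤ) < 0 →
      impose N p (glBracket N p f (constraint N p α)) = 0)
    (hg : ∀ α : ConstraintIndex N p, (α.1.2 : ℤ) < 0 →
      impose N p (glBracket N p (constraint N p α) g) = 0) :
    diracBracket N p f g = impose N p (glBracket N p f g) := by
  rw [diracBracket, sub_eq_self]
  refine Finset.sum_eq_zero fun α _ => Finset.sum_eq_zero fun β _ => ?_
  rcases lt_or_ge (α.1.2 : ℤ) 0 with h | h
  · rw [hf α h]; ring
  · rcases lt_or_ge (β.1.2 : ℤ) 0 with h' | h'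
    · rw [hg β h']; ring
    · rw [inv_diracMatrix_apply_eq_zero α β h h']; ring

end FiniteW

namespace FiniteW

open Matrix

variable {N p : ℕ}

/-! ### The bracket of `W_p(N)` is the Dirac bracket of arbitrary extensions -/

lemma diracBracket_sum_left {ι : Type*} (s : Finset ι) (c : ι → ℂ) (f : ι → Amb N p)
    (g : Amb N p) : diracBracket N p (∑ i ∈ s, MvPolynomial.C (c i) * f i) g =
      ∑ i ∈ s, MvPolynomial.C (c i) * diracBracket N p (f i) g := by
  rw [diracBracket_eq_sum_left]
  simp_rw [diracBracket_eq_sum_left (f _), Finset.mul_sum]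
  simp only [map_sum, derivation_C_mul, map_mul, impose_C, Finset.sum_mul]
  rw [Finset.sum_comm]
  exact Finset.sum_congr rfl fun _ _ => Finset.sum_congr rfl fun _ _ => mul_assoc _ _ _

lemma diracBracket_sum_right {ι : Type*} (s : Finset ι) (c : ι → ℂ) (f : ι → Amb N p)
    (g : Amb N p) : diracBracket N p g (∑ i ∈ s, MvPolynomial.C (c i) * f i) =
      ∑ i ∈ s, MvPolynomial.C (c i) * diracBracket N p g (f i) := by
  rw [diracBracket_eq_sum_right]
  simp_rw [diracBracket_eq_sum_right g (f _), Finset.mul_sum]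
  simp only [map_sum, derivation_C_mul, map_mul, impose_C, Finset.sum_mul]
  rw [Finset.sum_comm]
  exact Finset.sum_congr rfl fun _ _ => Finset.sum_congr rfl fun _ _ => mul_assoc _ _ _

/-- The coordinate `J^{ab}_{jj}` attached to the generator `W_j^{ab}`. -/
noncomputable def topCoord (i : Fin p × Fin N × Fin N) : Amb N p :=
  coord N p i.1 (i.1 : ℕ) i.2.1 i.2.2

lemma pderiv_gaugeFixed (i : Fin p × Fin N × Fin N) (x y : Fin N × Fin p) :
    MvPolynomial.pderiv i (gaugeFixed N p x y) =
      MvPolynomial.C (glBasis N p i.1 (i.1 : ℕ) i.2.1 i.2.2 x y) := by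
  classical
  have h : gaugeFixed N p x y = MvPolynomial.C (epsMinus N p x y) +
      ∑ k : Fin p × Fin N × Fin N, MvPolynomial.C (glBasis N p k.1 (k.1 : ℕ) k.2.1 k.2.2 x y) *
        MvPolynomial.X k := by
    simp only [gaugeFixed, Matrix.add_apply, map_apply, Matrix.sum_apply, Matrix.smul_apply,
      Fintype.sum_prod_type, W, of_apply, Fin.is_lt, dif_pos, smul_eq_mul, mul_comm]
  rw [h, map_add, MvPolynomial.pderiv_C, zero_add, map_sum, Finset.sum_eq_single i]
  · rw [derivation_C_mul, MvPolynomial.pderiv_X_self, mul_one]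
  · intro k _ hk
    rw [derivation_C_mul, MvPolynomial.pderiv_X_of_ne hk, mul_zero]
  · simp

lemma sum_multipletIndex_eq {F : MultipletIndex p → WAlgebra N p}
    (hF : ∀ i : MultipletIndex p, (i.2 : ℤ) < i.1 → F i = 0) :
    ∑ i, F i = ∑ j : Fin p, F ⟨j, (j : ℕ), Finset.mem_Icc.mpr ⟨by omega, le_rfl⟩⟩ := by
  rw [Fintype.sum_sigma]
  refine Finset.sum_congr rfl fun j _ => ?_
  rw [Finset.sum_eq_single]
  · rintro ⟨m, hm⟩ _ hne
    refine hF _ (lt_of_le_of_ne (Finset.mem_Icc.mp hm).2 fun h => hne ?_)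
    exact Subtype.ext h
  · simp

/-- In the expansion of an entry over the coordinates, those with m < j are Casimirs. The remaining
coefficients are the derivatives of the gauge fixed matrix, ready for the chain rule. -/
lemma diracBracket_X_left (x : (Fin N × Fin p) × (Fin N × Fin p)) (g : Amb N p) :
    diracBracket N p (MvPolynomial.X x) g =
      ∑ i, MvPolynomial.pderiv i (gaugeFixed N p x.1 x.2) * diracBracket N p (topCoord i) g := by
  have h : (MvPolynomial.X x : Amb N p) = ∑ i : MultipletIndex p × Fin N × Fin N,
      MvPolynomial.C (glBasis N p i.1.1 i.1.2 i.2.1 i.2.2 x.1 x.2) *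
        coord N p i.1.1 i.1.2 i.2.1 i.2.2 := by
    rw [X_eq_sum_coord x]
    simp only [Fintype.sum_prod_type]
  rw [h, diracBracket_sum_left, Fintype.sum_prod_type, Fintype.sum_prod_type,
    sum_multipletIndex_eq]
  · simp only [pderiv_gaugeFixed]
    rfl
  · rintro ⟨j, m, hm⟩ h
    refine Finset.sum_eq_zero fun ab _ => ?_
    rw [diracBracket_coord_left j m (Finset.mem_Icc.mp hm).1 h, mul_zero]

lemma diracBracket_X_right (x : (Fin N × Fin p) × (Fin N × Fin p)) (f : Amb N p) :
    diracBracket N p f (MvPolynomial.X x) =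
      ∑ i, MvPolynomial.pderiv i (gaugeFixed N p x.1 x.2) * diracBracket N p f (topCoord i) := by
  have h : (MvPolynomial.X x : Amb N p) = ∑ i : MultipletIndex p × Fin N × Fin N,
      MvPolynomial.C (glBasis N p i.1.1 i.1.2 i.2.1 i.2.2 x.1 x.2) *
        coord N p i.1.1 i.1.2 i.2.1 i.2.2 := by
    rw [X_eq_sum_coord x]
    simp only [Fintype.sum_prod_type]
  rw [h, diracBracket_sum_right, Fintype.sum_prod_type, Fintype.sum_prod_type,
    sum_multipletIndex_eq]
  · simp only [pderiv_gaugeFixed]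
    rfl
  · rintro ⟨j, m, hm⟩ h
    refine Finset.sum_eq_zero fun ab _ => ?_
    rw [diracBracket_coord_right j m (Finset.mem_Icc.mp hm).1 h, mul_zero]

lemma pderiv_impose (i : Fin p × Fin N × Fin N) (f : Amb N p) :
    MvPolynomial.pderiv i (impose N p f) = ∑ x, impose N p (MvPolynomial.pderiv x f) *
      MvPolynomial.pderiv i (gaugeFixed N p x.1 x.2) :=
  pderiv_aeval _ i f

lemma diracBracket_eq_sum_pderiv_left (f g : Amb N p) : diracBracket N p f g =
    ∑ i, MvPolynomial.pderiv i (impose N p f) * diracBracket N p (topCoord i) g := by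
  rw [diracBracket_eq_sum_left]
  simp_rw [pderiv_impose, diracBracket_X_left _ g, Finset.mul_sum, Finset.sum_mul]
  rw [Finset.sum_comm]
  exact Finset.sum_congr rfl fun _ _ => Finset.sum_congr rfl fun _ _ => (mul_assoc _ _ _).symm

lemma diracBracket_eq_sum_pderiv_right (f g : Amb N p) : diracBracket N p f g =
    ∑ i, MvPolynomial.pderiv i (impose N p g) * diracBracket N p f (topCoord i) := by
  rw [diracBracket_eq_sum_right]
  simp_rw [pderiv_impose, diracBracket_X_right _ f, Finset.mul_sum, Finset.sum_mul]
  rw [Finset.sum_comm]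
  exact Finset.sum_congr rfl fun _ _ => Finset.sum_congr rfl fun _ _ => (mul_assoc _ _ _).symm

/-- Elements of the W-algebra may thus be bracketed through any convenient extension to gl(Np), in
particular through entries of powers of 𝕁. -/
theorem wBracket_impose (f g : Amb N p) :
    wBracket N p (impose N p f) (impose N p g) = diracBracket N p f g := by
  rw [wBracket, biderivation, diracBracket_eq_sum_pderiv_left]
  simp_rw [diracBracket_eq_sum_pderiv_right _ g, Finset.mul_sum]
  exact Finset.sum_congr rfl fun _ _ => Finset.sum_congr rfl fun _ _ => mul_assoc _ _ _

/-! ### Brackets of powers of the generic matrix -/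

/-- Bracketing with x_{AB} is the commutator of 𝕁 with the elementary matrix E_{BA}. It is a
derivation, so powers of 𝕁 transform like 𝕁. -/
lemma glBracket_X_pow (A B C D : Fin N × Fin p) (m : ℕ) :
    glBracket N p (MvPolynomial.X (A, B)) ((genericMatrix N p ^ m) C D) =
      (if B = C then (genericMatrix N p ^ m) A D else 0) -
        (if A = D then (genericMatrix N p ^ m) C B else 0) := by
  have hX : ∀ k l, genericMatrix N p k l = MvPolynomial.X (k, l) := fun _ _ => rfl
  obtain ⟨E, hE⟩ := exists_derivation_glBracket_right N p (MvPolynomial.X (A, B))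
  induction m generalizing C D with
  | zero =>
    rw [hE, pow_zero, one_apply]
    have : E (if C = D then 1 else 0) = 0 := by split_ifs <;> simp
    rw [this]
    simp only [one_apply]
    by_cases h : B = C <;> by_cases h' : A = D <;> simp [h, h', eq_comm]
  | succ m ih =>
    rw [hE, pow_succ, mul_apply, map_sum]
    simp only [Derivation.leibniz]
    simp only [← hE, ih, hX, glBracket_X_X, smul_eq_mul, mul_sub, mul_ite,
      mul_zero, Finset.sum_add_distrib, Finset.sum_sub_distrib, Finset.sum_ite_eq,
      Finset.mem_univ, if_true, mul_apply]
    have h1 : ∀ P : Prop, [Decidable P] → ∀ F : Fin N × Fin p → Amb N p,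
        (∑ x, if P then F x else 0) = if P then ∑ x, F x else 0 := by
      intro P _ F
      split_ifs <;> simp
    rw [h1, h1]
    simp only [mul_comm (MvPolynomial.X (_ : (Fin N × Fin p) × (Fin N × Fin p)) : Amb N p)]
    ring

/-- Leibniz rule over the n factors of the first power: the factor preceded by 𝕁^i and followed by
𝕁^(n-1-i) gives the i-th summand. -/
lemma glBracket_pow_pow (A B C D : Fin N × Fin p) (n m : ℕ) :
    glBracket N p ((genericMatrix N p ^ n) A B) ((genericMatrix N p ^ m) C D) =
      ∑ i ∈ Finset.range n,
        ((genericMatrix N p ^ (m + i)) A D * (genericMatrix N p ^ (n - 1 - i)) C B -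
          (genericMatrix N p ^ i) A D * (genericMatrix N p ^ (n + m - 1 - i)) C B) := by
  have hX : ∀ k l, genericMatrix N p k l = MvPolynomial.X (k, l) := fun _ _ => rfl
  obtain ⟨E, hE⟩ := exists_derivation_glBracket_left N p ((genericMatrix N p ^ m) C D)
  induction n generalizing A B with
  | zero =>
    rw [hE, pow_zero, one_apply]
    split_ifs <;> simp
  | succ n ih =>
    rw [hE, pow_succ, mul_apply, map_sum, Finset.sum_range_succ]
    simp only [Derivation.leibniz, Finset.sum_add_distrib]
    simp only [← hE, ih, hX, glBracket_X_pow, smul_eq_mul]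
    rw [add_comm]
    congr 1
    · simp only [Finset.mul_sum]
      rw [Finset.sum_comm]
      refine Finset.sum_congr rfl fun i hi => ?_
      rw [Finset.mem_range] at hi
      rw [show n + 1 - 1 - i = (n - 1 - i) + 1 by omega,
        show n + 1 + m - 1 - i = (n + m - 1 - i) + 1 by omega, pow_succ, pow_succ _ (n + m - 1 - i),
        mul_apply, mul_apply, Finset.mul_sum, Finset.mul_sum, ← Finset.sum_sub_distrib]
      refine Finset.sum_congr rfl fun k _ => ?_
      rw [hX]
      ring
    · simp only [mul_sub, mul_ite, mul_zero, Finset.sum_sub_distrib, Finset.sum_ite_eq',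
        Finset.mem_univ, if_true]
      rw [show n + 1 - 1 - n = 0 by omega, show n + 1 + m - 1 - n = m by omega, pow_zero,
        one_apply]
      congr 1
      by_cases h : B = C
      · simp only [h, if_true, mul_one]
        rw [← mul_apply, ← pow_add, add_comm]
      · simp [h, Ne.symm h]

lemma glBracket_constraint_pow {q : ℕ} (α : ConstraintIndex N (q + 1)) (hα : (α.1.2 : ℤ) < 0)
    (n : ℕ) (a b : Fin N) :
    glBracket N (q + 1) (constraint N (q + 1) α)
      ((genericMatrix N (q + 1) ^ n) (a, Fin.last q) (b, 0)) = 0 := by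
  obtain ⟨⟨j, m, hm⟩, a', b'⟩ := α
  rw [Finset.mem_Ico] at hm
  simp only at hα
  rw [glBracket_constraint_left, coord_eq, glBracket_C_mul_left, glBracket_blockForm_left,
    Finset.sum_eq_zero, mul_zero]
  refine fun k _ => Finset.sum_eq_zero fun l _ => ?_
  -- A nonzero coefficient forces k > l, so l is not the last index and k is not the first; both
  -- Kronecker deltas vanish.
  by_cases h : (k : ℤ) - l = -m
  · have hl : l ≠ Fin.last q := by
      rintro rfl
      have := k.is_le
      simp only [Fin.val_last] at h
      omega
    have hk : k ≠ 0 := by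
      rintro rfl
      simp only [Fin.val_zero] at h
      omega
    rw [glBracket_X_pow, if_neg (by simp [hl]), if_neg (by simp [hk]), sub_zero, mul_zero]
  · rw [multiplet_apply_eq_zero _ _ _ (by simp only; omega) _ _ h, map_zero, zero_mul]

/-! ### The corner blocks of the powers of the gauge fixed matrix -/

/-- The lower left `N × N` block of the `n`-th power of the gauge fixed matrix. -/
noncomputable def corner (N q n : ℕ) : Matrix (Fin N) (Fin N) (WAlgebra N (q + 1)) :=
  of fun a b => (gaugeFixed N (q + 1) ^ n) (a, Fin.last q) (b, 0)

lemma impose_pow (n : ℕ) (A B : Fin N × Fin p) :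
    impose N p ((genericMatrix N p ^ n) A B) = (gaugeFixed N p ^ n) A B := by
  have h : (impose N p).mapMatrix (genericMatrix N p) = gaugeFixed N p := by
    ext A B
    simp [genericMatrix, impose_X]
  rw [← h, ← map_pow]
  rfl

theorem wBracket_corner (q n m : ℕ) (a b c d : Fin N) :
    wBracket N (q + 1) (corner N q n a b) (corner N q m c d) =
      ∑ i ∈ Finset.range n, (corner N q (m + i) a d * corner N q (n - 1 - i) c b -
        corner N q i a d * corner N q (n + m - 1 - i) c b) := by
  simp only [corner, of_apply]
  rw [← impose_pow, ← impose_pow, wBracket_impose, diracBracket_of_commute, glBracket_pow_pow,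
    map_sum]
  · simp only [map_sub, map_mul, impose_pow]
  · intro α hα
    rw [glBracket_antisymm, glBracket_constraint_pow α hα, neg_zero, map_zero]
  · intro α hα
    rw [glBracket_constraint_pow α hα, map_zero]

end FiniteW

namespace FiniteW

open Matrix

variable {N p : ℕ}

/-! ### Words in the matrices `W_s` -/

variable (N p) in
/-- The product `W_{s₁} ⋯ W_{sₙ}`. -/
noncomputable def word (s : List ℕ) : Matrix (Fin N) (Fin N) (WAlgebra N p) :=
  (s.map (W N p)).prod

/-- The weight `∑ (sᵢ + 1)` of a word. -/
def wordWeight (s : List ℕ) : ℕ := (s.map (· + 1)).sum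

lemma wordWeight_append (s t : List ℕ) :
    wordWeight (s ++ t) = wordWeight s + wordWeight t := by
  simp [wordWeight]

lemma wordWeight_cons (a : ℕ) (s : List ℕ) : wordWeight (a :: s) = a + 1 + wordWeight s := by
  simp [wordWeight]

lemma word_append (s t : List ℕ) : word N p (s ++ t) = word N p s * word N p t := by
  simp [word]

lemma word_cons (a : ℕ) (s : List ℕ) : word N p (a :: s) = W N p a * word N p s := by
  simp [word]

lemma wordWeight_eq (s : List ℕ) : wordWeight s = s.sum + s.length := by
  induction s with
  | nil => rfl
  | cons a s ih => rw [wordWeight_cons, ih, List.sum_cons, List.length_cons]; ring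

lemma length_le_wordWeight (s : List ℕ) : s.length ≤ wordWeight s := by
  rw [wordWeight_eq]; omega

variable (N p) in
/-- The span of the words of a given weight. -/
noncomputable def homogeneous (w : ℕ) : Submodule ℂ (Matrix (Fin N) (Fin N) (WAlgebra N p)) :=
  Submodule.span ℂ {A | ∃ s, wordWeight s = w ∧ word N p s = A}

variable (N p) in
/-- The span of the words of a given weight with at least two letters. -/
noncomputable def decomposable (w : ℕ) : Submodule ℂ (Matrix (Fin N) (Fin N) (WAlgebra N p)) :=
  Submodule.span ℂ {A | ∃ s, wordWeight s = w ∧ 2 ≤ s.length ∧ word N p s = A}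

lemma word_mem_homogeneous (s : List ℕ) : word N p s ∈ homogeneous N p (wordWeight s) :=
  Submodule.subset_span ⟨s, rfl, rfl⟩

lemma W_mem_homogeneous (j : ℕ) : W N p j ∈ homogeneous N p (j + 1) := by
  simpa [word, wordWeight] using word_mem_homogeneous (N := N) (p := p) [j]

lemma one_mem_homogeneous : (1 : Matrix (Fin N) (Fin N) (WAlgebra N p)) ∈ homogeneous N p 0 := by
  simpa [word, wordWeight] using word_mem_homogeneous (N := N) (p := p) []

lemma mul_mem_homogeneous {u v : ℕ} {A B : Matrix (Fin N) (Fin N) (WAlgebra N p)}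
    (hA : A ∈ homogeneous N p u) (hB : B ∈ homogeneous N p v) :
    A * B ∈ homogeneous N p (u + v) := by
  have h := Submodule.mul_mem_mul hA hB
  rw [homogeneous, homogeneous, Submodule.span_mul_span] at h
  refine Submodule.span_mono ?_ h
  rintro _ ⟨_, ⟨s, rfl, rfl⟩, _, ⟨t, rfl, rfl⟩, rfl⟩
  exact ⟨s ++ t, wordWeight_append s t, word_append s t⟩

/-- A word of positive weight is nonempty, so the concatenation has at least two letters. -/
lemma mul_mem_decomposable {u v : ℕ} {A B : Matrix (Fin N) (Fin N) (WAlgebra N p)}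
    (hA : A ∈ homogeneous N p u) (hB : B ∈ homogeneous N p v) (hu : 0 < u) (hv : 0 < v) :
    A * B ∈ decomposable N p (u + v) := by
  have h := Submodule.mul_mem_mul hA hB
  rw [homogeneous, homogeneous, Submodule.span_mul_span] at h
  refine Submodule.span_mono ?_ h
  rintro _ ⟨_, ⟨s, rfl, rfl⟩, _, ⟨t, rfl, rfl⟩, rfl⟩
  refine ⟨s ++ t, wordWeight_append s t, ?_, word_append s t⟩
  cases s <;> cases t <;> simp_all [wordWeight]
  omega

/-! ### Blocks of powers of the gauge fixed matrix -/

variable (N p) in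
/-- The `(k, l)` block of the `n`-th power of the gauge fixed matrix. -/
noncomputable def block (n : ℕ) (k l : Fin p) : Matrix (Fin N) (Fin N) (WAlgebra N p) :=
  of fun a b => (gaugeFixed N p ^ n) (a, k) (b, l)

lemma block_zero (k l : Fin p) : block N p 0 k l = if k = l then 1 else 0 := by
  ext1 a b
  by_cases h : k = l <;> simp [block, one_apply, h]

/-- The `(k, l)` block of the gauge fixed matrix. -/
lemma block_one (k l : Fin p) : block N p 1 k l = eMinus p k l • 1 +
    if (k : ℕ) ≤ l then highest p (l - k) k l • W N p (l - k) else 0 := by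
  ext1 a b
  rw [block, of_apply, pow_one, gaugeFixed_apply, Matrix.add_apply]
  congr 1
  · by_cases h : a = b
    · subst h
      simp [MvPolynomial.smul_eq_C_mul]
    · simp [h]
  · split_ifs
    · simp [MvPolynomial.smul_eq_C_mul]
    · simp

lemma block_succ (n : ℕ) (k l : Fin p) :
    block N p (n + 1) k l = ∑ m, block N p n k m * block N p 1 m l := by
  ext1 a b
  simp only [block, of_apply, pow_succ _ n, mul_apply, Fintype.sum_prod_type, pow_one,
    Matrix.sum_apply]
  rw [Finset.sum_comm]

lemma block_one_eq_one {k l : Fin p} (h : (k : ℕ) = l + 1) : block N p 1 k l = 1 := by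
  rw [block_one, eMinus_apply, if_pos h, if_neg (by omega), one_smul, add_zero]

lemma block_one_of_le {k l : Fin p} (h : (k : ℕ) ≤ l) :
    block N p 1 k l = highest p (l - k) k l • W N p (l - k) := by
  rw [block_one, eMinus_apply, if_neg (by omega), if_pos h, zero_smul, zero_add]

lemma block_one_of_lt {k l : Fin p} (h : (l : ℕ) + 1 < k) : block N p 1 k l = 0 := by
  rw [block_one, eMinus_apply, if_neg (by omega), if_neg (by omega), zero_smul, zero_add]

lemma block_eq_zero {n : ℕ} {k l : Fin p} (h : n + (l : ℕ) < k) : block N p n k l = 0 := by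
  induction n generalizing l with
  | zero =>
    rw [block_zero, if_neg]
    rintro rfl
    omega
  | succ n ih =>
    rw [block_succ]
    refine Finset.sum_eq_zero fun m _ => ?_
    rcases lt_or_ge ((l : ℕ) + 1) m with hm | hm
    · rw [block_one_of_lt hm, mul_zero]
    · rw [ih (by omega), zero_mul]

lemma block_eq_one {n : ℕ} {k l : Fin p} (h : n + (l : ℕ) = k) : block N p n k l = 1 := by
  induction n generalizing l with
  | zero => rw [block_zero, if_pos (Fin.ext (by omega))]
  | succ n ih =>
    rw [block_succ, Finset.sum_eq_single (⟨l + 1, by omega⟩ : Fin p)]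
    · rw [ih (by simp only; omega), block_one_eq_one rfl, one_mul]
    · intro m _ hm
      have hm' : (m : ℕ) ≠ l + 1 := fun h => hm (Fin.ext h)
      rcases lt_or_ge ((l : ℕ) + 1) m with hm | hm
      · rw [block_one_of_lt hm, mul_zero]
      · rw [block_eq_zero (by omega), zero_mul]
    · simp

/-- The (k, l) block of J has weight 1 + l - k, the entries of e₋ having weight zero, and weights
add in products. -/
lemma block_mem_homogeneous {n w : ℕ} {k l : Fin p} (h : n + (l : ℕ) = k + w) :
    block N p n k l ∈ homogeneous N p w := by
  induction n generalizing l w with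
  | zero =>
    rw [block_zero]
    split_ifs with hkl
    · subst hkl
      obtain rfl : w = 0 := by omega
      exact one_mem_homogeneous
    · exact zero_mem _
  | succ n ih =>
    rw [block_succ]
    refine Submodule.sum_mem _ fun m _ => ?_
    rcases lt_trichotomy (m : ℕ) (l + 1) with hm | hm | hm
    · rcases lt_or_ge (n + (m : ℕ)) k with hk | hk
      · rw [block_eq_zero hk, zero_mul]
        exact zero_mem _
      · obtain ⟨u, hu⟩ := Nat.exists_eq_add_of_le hk
        rw [block_one_of_le (by omega), mul_smul_comm]
        have := mul_mem_homogeneous (ih hu) (W_mem_homogeneous (N := N) (p := p) (l - m))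
        rw [show u + (l - m + 1) = w by omega] at this
        exact Submodule.smul_mem _ _ this
    · rw [block_one_eq_one hm, mul_one]
      exact ih (by omega)
    · rw [block_one_of_lt hm, mul_zero]
      exact zero_mem _

/-- The coefficient matrix of `W_j` in the `n`-th power of the gauge fixed matrix. -/
noncomputable def linearPart (p j n : ℕ) : Matrix (Fin p) (Fin p) ℂ :=
  ∑ i ∈ Finset.range n, eMinus p ^ i * highest p j * eMinus p ^ (n - 1 - i)

lemma linearPart_succ (p j n : ℕ) :
    linearPart p j (n + 1) = eMinus p ^ n * highest p j + linearPart p j n * eMinus p := by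
  rw [linearPart, Finset.sum_range_succ, add_comm]
  congr 1
  · rw [show n + 1 - 1 - n = 0 by omega, pow_zero, mul_one]
  · rw [linearPart, Finset.sum_mul]
    refine Finset.sum_congr rfl fun i hi => ?_
    rw [Finset.mem_range] at hi
    rw [show n + 1 - 1 - i = (n - 1 - i) + 1 by omega, pow_succ, mul_assoc, mul_assoc, mul_assoc]

/-- Splitting off the last factor, a product of two blocks of positive weight is decomposable. A
linear term therefore needs a weight zero block on one side, and such a block is 1. -/
lemma block_sub_mem_decomposable {j n : ℕ} {k l : Fin p} (h : n + (l : ℕ) = k + (j + 1)) :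
    block N p n k l - linearPart p j n k l • W N p j ∈ decomposable N p (j + 1) := by
  induction n generalizing l with
  | zero =>
    rw [block_zero, if_neg (by rintro rfl; omega)]
    simp [linearPart]
  | succ n ih =>
    have hsum : block N p (n + 1) k l - linearPart p j (n + 1) k l • W N p j =
        ∑ m, (block N p n k m * block N p 1 m l - ((eMinus p ^ n) k m * highest p j m l) • W N p j -
          (linearPart p j n k m * eMinus p m l) • W N p j) := by
      rw [block_succ, linearPart_succ, Finset.sum_sub_distrib, Finset.sum_sub_distrib,
        ← Finset.sum_smul, ← Finset.sum_smul, Matrix.add_apply, mul_apply, mul_apply, add_smul,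
        sub_sub]
    rw [hsum]
    refine Submodule.sum_mem _ fun m _ => ?_
    rcases lt_trichotomy (m : ℕ) (l + 1) with hm | hm | hm
    · rw [eMinus_apply p m l, if_neg (by omega), mul_zero, zero_smul, sub_zero,
        eMinus_pow_apply]
      rcases lt_trichotomy (n + (m : ℕ)) k with hk | hk | hk
      · rw [block_eq_zero hk, if_neg (by omega)]
        simp
      · rw [block_eq_one hk, if_pos (by omega), one_mul, one_mul, block_one_of_le (by omega),
          show (l : ℕ) - m = j by omega, sub_self]
        exact zero_mem _
      · obtain ⟨u, hu⟩ := Nat.exists_eq_add_of_lt hk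
        rw [block_one_of_le (by omega), mul_smul_comm, if_neg (by omega), zero_mul, zero_smul,
          sub_zero]
        have := mul_mem_decomposable
          (block_mem_homogeneous (N := N) (n := n) (w := u + 1) (k := k) (l := m) (by omega))
          (W_mem_homogeneous (N := N) (p := p) (l - m)) (by omega) (by omega)
        rw [show u + 1 + (l - m + 1) = j + 1 by omega] at this
        exact Submodule.smul_mem _ _ this
    · rw [block_one_eq_one hm, mul_one, highest_apply_of_ne (by omega), mul_zero, zero_smul,
        sub_zero, eMinus_apply, if_pos hm, mul_one]
      exact ih (by omega)
    · rw [block_one_of_lt hm, mul_zero, highest_apply_of_ne (by omega), eMinus_apply p m l,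
        if_neg (by omega)]
      simp

open scoped ComplexOrder in
lemma linearPart_corner_ne_zero (q j : ℕ) (hj : j < q + 1) :
    linearPart (q + 1) j (q + 1 + j) (Fin.last q) 0 ≠ 0 := by
  have he : ∀ (i : ℕ) (k l : Fin (q + 1)), 0 ≤ (eMinus (q + 1) ^ i) k l := fun i k l => by
    rw [eMinus_pow_apply]
    split_ifs <;> simp
  have hnn : ∀ (i r : ℕ) (x y : Fin (q + 1)), 0 ≤ (eMinus (q + 1) ^ i) (Fin.last q) x *
      highest (q + 1) j x y * (eMinus (q + 1) ^ r) y 0 := fun i r x y =>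
    mul_nonneg (mul_nonneg (he _ _ _) (highest_nonneg _ _ _ _)) (he _ _ _)
  have hentry : ∀ i r : ℕ, (eMinus (q + 1) ^ i * highest (q + 1) j * eMinus (q + 1) ^ r)
      (Fin.last q) 0 = ∑ y, ∑ x, (eMinus (q + 1) ^ i) (Fin.last q) x *
      highest (q + 1) j x y * (eMinus (q + 1) ^ r) y 0 := fun i r => by
    simp only [mul_apply, Finset.sum_mul]
  apply ne_of_gt
  rw [linearPart, Matrix.sum_apply]
  -- The summand i = q contains the path q → 0 → j → 0, whose contribution is positive; all others
  -- are nonnegative.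
  refine Finset.sum_pos' (fun i _ => ?_) ⟨q, by simp; omega, ?_⟩
  · rw [hentry]
    exact Finset.sum_nonneg fun y _ => Finset.sum_nonneg fun x _ => hnn _ _ _ _
  · rw [hentry]
    refine Finset.sum_pos' (fun y _ => Finset.sum_nonneg fun x _ => hnn _ _ _ _)
      ⟨⟨j, hj⟩, Finset.mem_univ _, ?_⟩
    refine Finset.sum_pos' (fun x _ => hnn _ _ _ _) ⟨0, Finset.mem_univ _, ?_⟩
    rw [eMinus_pow_apply, eMinus_pow_apply, if_pos (by simp), if_pos (by simp), one_mul, mul_one]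
    exact highest_pos _ _ _ _ (by simp)

/-- The only possible path is q → q-i → q+1-i → 0. For i = 0 and i = q + 1 it leaves the index
range, and the right-hand side vanishes as well. -/
lemma eMinus_pow_mul_highest_one_apply (q i : ℕ) (hi : i ≤ q + 1) :
    (eMinus (q + 1) ^ i * highest (q + 1) 1 * eMinus (q + 1) ^ (q + 1 - i)) (Fin.last q) 0 =
      ((q : ℂ) + 1 - i) * i := by
  simp only [mul_apply, Finset.sum_mul, eMinus_pow_apply]
  rcases Nat.eq_zero_or_pos i with rfl | h0
  · simp only [CharP.cast_eq_zero, mul_zero]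
    refine Finset.sum_eq_zero fun y _ => ?_
    have := y.is_le
    rw [if_neg (c := (y : ℕ) = _) (by simp; omega)]
    simp
  rcases Nat.eq_or_lt_of_le hi with rfl | h1
  · have : ((q : ℂ) + 1 - (q + 1 : ℕ)) = 0 := by push_cast; ring
    rw [this, zero_mul]
    refine Finset.sum_eq_zero fun y _ => Finset.sum_eq_zero fun x _ => ?_
    rw [if_neg (by simp; omega)]
    simp
  · rw [Finset.sum_eq_single (⟨q + 1 - i, by omega⟩ : Fin (q + 1)),
      Finset.sum_eq_single (⟨q - i, by omega⟩ : Fin (q + 1))]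
    · rw [highest_one_apply (by simp only; omega), if_pos (by simp; omega), if_pos (by simp)]
      simp only
      rw [Nat.cast_sub (by omega)]
      push_cast
      ring
    · intro x _ hx
      rw [if_neg, zero_mul, zero_mul]
      intro h
      exact hx (Fin.ext (by simp at h ⊢; omega))
    · simp
    · intro y _ hy
      refine Finset.sum_eq_zero fun x _ => ?_
      rw [if_neg (c := (y : ℕ) = _), mul_zero]
      intro h
      exact hy (Fin.ext (by simpa using h))
    · simp

lemma linearPart_corner_one (q : ℕ) : linearPart (q + 1) 1 (q + 2) (Fin.last q) 0 =
    ((q + 1 : ℕ) : ℂ) * (((q + 1 : ℕ) : ℂ) ^ 2 - 1) / 6 := by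
  have hs : ∀ n : ℕ, ∀ c : ℂ, ∑ i ∈ Finset.range n, (c - i) * i =
      c * (n * (n - 1) / 2) - (n - 1) * n * (2 * n - 1) / 6 := by
    intro n c
    induction n with
    | zero => simp
    | succ n ih =>
      rw [Finset.sum_range_succ, ih]
      push_cast
      ring
  rw [linearPart, Matrix.sum_apply, show q + 2 - 1 = q + 1 from rfl]
  rw [Finset.sum_congr rfl fun i hi => eMinus_pow_mul_highest_one_apply q i
    (by rw [Finset.mem_range] at hi; omega), hs]
  push_cast
  ring

end FiniteW

namespace FiniteW

open Matrix

variable {N p : ℕ}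

/-! ### Consequences of the structure of a family -/

/-- A letter s weighs s + 1, so a word of weight j + 1 with n letters has index sum j + 1 - n. -/
lemma exists_coefficients {j : ℕ} {A : Matrix (Fin N) (Fin N) (WAlgebra N p)}
    (hA : A ∈ homogeneous N p (j + 1)) : ∃ α : (n : ℕ) → (Fin n → ℕ) → ℂ, A =
      ∑ n ∈ Finset.Icc 1 (j + 1), ∑ s ∈ Finset.Nat.antidiagonalTuple n (j + 1 - n),
        α n s • (List.ofFn fun i => W N p (s i)).prod := by
  have hword : ∀ (n : ℕ) (s : Fin n → ℕ),
      (List.ofFn fun i => W N p (s i)).prod = word N p (List.ofFn s) := fun n s => by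
    rw [word, List.map_ofFn]; rfl
  simp only [hword]
  induction hA using Submodule.span_induction with
  | mem A h =>
    obtain ⟨l, hl, rfl⟩ := h
    have hlen : 1 ≤ l.length := by
      cases l
      · simp [wordWeight] at hl
      · simp
    have hw := wordWeight_eq l
    refine ⟨fun n s => if List.ofFn s = l then 1 else 0, ?_⟩
    rw [Finset.sum_eq_single l.length, Finset.sum_eq_single l.get]
    · simp
    · intro s _ hs
      simp only
      rw [if_neg, zero_smul]
      intro h
      apply hs
      apply List.ofFn_injective
      rw [h, List.ofFn_get]
    · intro h
      refine absurd (Finset.Nat.mem_antidiagonalTuple.mpr ?_) h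
      have : ∑ i, l.get i = l.sum := by rw [← List.sum_ofFn, List.ofFn_get]
      omega
    · intro n _ hn
      refine Finset.sum_eq_zero fun s _ => ?_
      simp only
      rw [if_neg, zero_smul]
      rintro rfl
      simp at hn
    · intro h
      refine absurd (Finset.mem_Icc.mpr ⟨hlen, ?_⟩) h
      omega
  | zero => exact ⟨fun _ _ => 0, by simp⟩
  | add A B _ _ hA hB =>
    obtain ⟨α, hα⟩ := hA
    obtain ⟨β, hβ⟩ := hB
    refine ⟨fun n s => α n s + β n s, ?_⟩
    simp only [add_smul, Finset.sum_add_distrib]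
    rw [← hα, ← hβ]
  | smul c A _ hA =>
    obtain ⟨α, hα⟩ := hA
    refine ⟨fun n s => c * α n s, ?_⟩
    simp only [mul_smul, ← Finset.smul_sum]
    rw [← hα]

lemma totalDegree_word_le (s : List ℕ) (a b : Fin N) :
    (word N p s a b).totalDegree ≤ s.length := by
  induction s generalizing a b with
  | nil =>
    by_cases h : a = b <;> simp [word, h]
  | cons x s ih =>
    rw [word_cons, mul_apply]
    refine MvPolynomial.totalDegree_finsetSum_le fun c _ => ?_
    refine (MvPolynomial.totalDegree_mul _ _).trans ?_
    rw [List.length_cons, add_comm]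
    refine Nat.add_le_add (ih c b) ?_
    rw [W, of_apply]
    split_ifs
    · rw [MvPolynomial.totalDegree_X]
    · simp

lemma totalDegree_le_of_mem_homogeneous {w : ℕ} {A : Matrix (Fin N) (Fin N) (WAlgebra N p)}
    (hA : A ∈ homogeneous N p w) (a b : Fin N) : (A a b).totalDegree ≤ w := by
  induction hA using Submodule.span_induction with
  | mem A h =>
    obtain ⟨l, rfl, rfl⟩ := h
    exact (totalDegree_word_le l a b).trans (length_le_wordWeight l)
  | zero => simp
  | add A B _ _ hA hB => exact (MvPolynomial.totalDegree_add _ _).trans (max_le hA hB)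
  | smul c A _ hA => exact (MvPolynomial.totalDegree_smul_le _ _).trans hA

/-! ### Triangularity, generation and algebraic independence. -/

lemma letter_lt {s : List ℕ} {j : ℕ} (hs : wordWeight s = j + 1) (h2 : 2 ≤ s.length) {x : ℕ}
    (hx : x ∈ s) : x < j := by
  have := List.single_le_sum (fun _ _ => Nat.zero_le _) x hx
  rw [wordWeight_eq] at hs
  omega

lemma mem_matrix_of_mem_decomposable {j : ℕ} (S : Subalgebra ℂ (WAlgebra N p))
    (hS : ∀ s < j, W N p s ∈ S.matrix) {A : Matrix (Fin N) (Fin N) (WAlgebra N p)}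
    (hA : A ∈ decomposable N p (j + 1)) : A ∈ (S.matrix : Subalgebra ℂ _) := by
  have : decomposable N p (j + 1) ≤
      Subalgebra.toSubmodule (S.matrix : Subalgebra ℂ (Matrix (Fin N) (Fin N) _)) := by
    refine Submodule.span_le.mpr ?_
    rintro _ ⟨s, hs, h2, rfl⟩
    refine Subalgebra.list_prod_mem _ fun y hy => ?_
    obtain ⟨x, hx, rfl⟩ := List.mem_map.mp hy
    exact hS x (letter_lt hs h2 hx)
  exact this hA

/-- The decomposable part of V_j involves only W_s with s < j, so the W_j are recovered one after
another by dividing by c. -/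
lemma adjoin_range_eq_top (V : ℕ → Matrix (Fin N) (Fin N) (WAlgebra N p))
    (hV : ∀ j < p, ∃ c : ℂ, c ≠ 0 ∧ V j - c • W N p j ∈ decomposable N p (j + 1)) :
    Algebra.adjoin ℂ (Set.range fun i : Fin p × Fin N × Fin N => V i.1 i.2.1 i.2.2) = ⊤ := by
  set S := Algebra.adjoin ℂ (Set.range fun i : Fin p × Fin N × Fin N => V i.1 i.2.1 i.2.2)
  have hW : ∀ j, W N p j ∈ (S.matrix : Subalgebra ℂ (Matrix (Fin N) (Fin N) _)) := by
    intro j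
    induction j using Nat.strong_induction_on with
    | _ j ih =>
      by_cases hj : j < p
      · obtain ⟨c, hc, h⟩ := hV j hj
        have h1 := mem_matrix_of_mem_decomposable S ih h
        have h2 : V j ∈ (S.matrix : Subalgebra ℂ (Matrix (Fin N) (Fin N) _)) :=
          fun a b => Algebra.subset_adjoin ⟨(⟨j, hj⟩, a, b), rfl⟩
        have h3 := Subalgebra.smul_mem _ (Subalgebra.sub_mem _ h2 h1) c⁻¹
        rwa [sub_sub_cancel, smul_smul, inv_mul_cancel₀ hc, one_smul] at h3
      · have : W N p j = 0 := by
          ext1 a b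
          simp [W, hj]
        rw [this]
        exact zero_mem _
  rw [eq_top_iff, ← MvPolynomial.adjoin_range_X, Algebra.adjoin_le_iff]
  rintro _ ⟨⟨j, a, b⟩, rfl⟩
  have := hW j a b
  simpa [W] using this

/-- The kernels of the iterates stabilise, say at n. Writing an element of the kernel of f as f^n(y)
puts y in ker f^(n+1) = ker f^n. -/
lemma injective_of_surjective_of_isNoetherianRing {A : Type*} [CommRing A] [IsNoetherianRing A]
    (f : A →+* A) (hf : Function.Surjective f) : Function.Injective f := by
  rw [injective_iff_map_eq_zero]
  intro x hx
  let K : ℕ →o Ideal A := ⟨fun n => RingHom.ker (f ^ n), monotone_nat_of_le_succ fun n y hy => by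
    rw [RingHom.mem_ker] at hy ⊢
    rw [pow_succ', RingHom.mul_def, RingHom.comp_apply, hy, map_zero]⟩
  obtain ⟨n, hn⟩ := monotone_stabilizes_iff_noetherian.mpr ‹IsNoetherianRing A› K
  have hs : Function.Surjective (f ^ n) := by
    rw [RingHom.coe_pow]
    exact hf.iterate n
  obtain ⟨y, rfl⟩ := hs x
  have hy : y ∈ K (n + 1) := by
    change (f ^ (n + 1)) y = 0
    rw [pow_succ', RingHom.mul_def, RingHom.comp_apply, hx]
  rw [← hn (n + 1) (Nat.le_succ n)] at hy
  exact hy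

lemma algebraicIndependent_of_adjoin_eq_top {σ : Type} [Finite σ] (v : σ → MvPolynomial σ ℂ)
    (hv : Algebra.adjoin ℂ (Set.range v) = ⊤) : AlgebraicIndependent ℂ v := by
  rw [AlgebraicIndependent]
  refine injective_of_surjective_of_isNoetherianRing
    (MvPolynomial.aeval (R := ℂ) v).toRingHom ?_
  rw [Algebra.adjoin_range_eq_range_aeval] at hv
  exact AlgHom.range_eq_top _ |>.mp hv

/-! ### Specialisation at `W_0` with equal entries -/

variable (N p) in
/-- The specialisation `W_0^{ab} ↦ X`, `W_s^{ab} ↦ 0` for `s > 0`. -/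
noncomputable def specialize : WAlgebra N p →ₐ[ℂ] Polynomial ℂ :=
  MvPolynomial.aeval fun i => if (i.1 : ℕ) = 0 then Polynomial.X else 0

lemma natDegree_specialize_le (f : WAlgebra N p) :
    (specialize N p f).natDegree ≤ f.totalDegree := by
  refine (MvPolynomial.aeval_natDegree_le f le_rfl _ (n := 1) fun i => ?_).trans (by simp)
  split_ifs <;> simp

variable (N) in
/-- The matrix all of whose entries are `X`. -/
noncomputable def constMatrix : Matrix (Fin N) (Fin N) (Polynomial ℂ) :=
  of fun _ _ => Polynomial.X

lemma constMatrix_pow_apply (n : ℕ) (a b : Fin N) :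
    (constMatrix N ^ (n + 1)) a b = (N : Polynomial ℂ) ^ n * Polynomial.X ^ (n + 1) := by
  induction n generalizing b with
  | zero => simp [constMatrix]
  | succ n ih =>
    rw [pow_succ, mul_apply]
    simp only [ih]
    simp only [constMatrix, of_apply, Finset.sum_const, Finset.card_univ, Fintype.card_fin,
      nsmul_eq_mul]
    ring

/-- Homogeneity bounds the degree above. Substituting polynomials of degree at most one cannot raise
it, so a nonzero specialised term of degree j + 1 bounds it below. -/
lemma totalDegree_eq_of_specialize {j : ℕ} {A : Matrix (Fin N) (Fin N) (WAlgebra N p)}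
    (hA : A ∈ homogeneous N p (j + 1)) {c : ℕ} (hc : c ≠ 0)
    (h : (specialize N p).mapMatrix A = c • constMatrix N ^ (j + 1)) (a b : Fin N) :
    (A a b).totalDegree = j + 1 := by
  refine le_antisymm (totalDegree_le_of_mem_homogeneous hA a b) ?_
  refine le_trans ?_ (natDegree_specialize_le (A a b))
  have h1 : specialize N p (A a b) =
      Polynomial.C ((c : ℂ) * (N : ℂ) ^ j) * Polynomial.X ^ (j + 1) := by
    have := congrFun (congrFun h a) b
    rw [Matrix.smul_apply, constMatrix_pow_apply] at this
    rw [AlgHom.mapMatrix_apply, map_apply] at this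
    rw [this]
    simp [mul_assoc]
  have hN : (N : ℂ) ≠ 0 := by
    have := a.pos
    exact_mod_cast this.ne'
  rw [h1, Polynomial.natDegree_C_mul_X_pow]
  exact mul_ne_zero (by exact_mod_cast hc) (pow_ne_zero _ hN)

lemma specialize_W_zero (hp : 0 < p) : (specialize N p).mapMatrix (W N p 0) = constMatrix N := by
  ext1 a b
  simp [W, hp, specialize, constMatrix]

lemma specialize_W_of_pos {s : ℕ} (hs : 0 < s) : (specialize N p).mapMatrix (W N p s) = 0 := by
  ext1 a b
  by_cases h : s < p <;> simp [W, specialize, h, hs.ne']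

/-- Since M_{0,0} = 1, the specialised J is the sum of 1 ⊗ e₋ and `constMatrix` ⊗ 1, which commute.
The binomial theorem applies, here through Pascal's rule. -/
lemma specialize_block {n w : ℕ} {k l : Fin p} (h : n + (l : ℕ) = k + w) :
    (specialize N p).mapMatrix (block N p n k l) = n.choose w • constMatrix N ^ w := by
  have hp : 0 < p := k.pos
  induction n generalizing l w with
  | zero =>
    rw [block_zero]
    rcases Nat.eq_zero_or_pos w with rfl | hw
    · rw [if_pos (Fin.ext (by omega)), map_one]
      simp
    · rw [if_neg (by rintro rfl; omega), map_zero, Nat.choose_eq_zero_of_lt hw, zero_smul]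
  | succ n ih =>
    rcases Nat.eq_zero_or_pos w with rfl | hw
    · rw [block_eq_one (by omega), map_one]
      simp
    obtain ⟨w, rfl⟩ : ∃ v, w = v + 1 := ⟨w - 1, by omega⟩
    have hdown : (specialize N p).mapMatrix
        (∑ m ∈ Finset.univ.filter (fun m : Fin p => ¬ (m : ℕ) ≤ l),
          block N p n k m * block N p 1 m l) = n.choose (w + 1) • constMatrix N ^ (w + 1) := by
      by_cases hl : (l : ℕ) + 1 < p
      · rw [Finset.sum_eq_single (⟨l + 1, hl⟩ : Fin p)]
        · rw [block_one_eq_one rfl, mul_one, ih (w := w + 1) (by simp only; omega)]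
        · intro m hm hne
          have h1 : (m : ℕ) ≠ l + 1 := fun h => hne (Fin.ext h)
          simp only [Finset.mem_filter, Finset.mem_univ, true_and] at hm
          rw [block_one_of_lt (by omega), mul_zero]
        · intro h
          exact absurd (Finset.mem_filter.mpr ⟨Finset.mem_univ _, by simp only; omega⟩) h
      -- In the last column e₋ has no entry; there w ≥ n, so the binomial coefficient vanishes too.
      · rw [Nat.choose_eq_zero_of_lt (by omega), zero_smul, Finset.sum_eq_zero, map_zero]
        intro m hm
        simp only [Finset.mem_filter, Finset.mem_univ, true_and] at hm
        omega
    have hup : (specialize N p).mapMatrix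
        (∑ m ∈ Finset.univ.filter (fun m : Fin p => (m : ℕ) ≤ l),
          block N p n k m * block N p 1 m l) = n.choose w • constMatrix N ^ (w + 1) := by
      rw [map_sum, Finset.sum_eq_single l, map_mul, ih (w := w) (by omega), block_one_of_le le_rfl,
        Nat.sub_self, highest_zero, one_apply_eq, one_smul, specialize_W_zero hp, smul_mul_assoc,
        pow_succ]
      · intro m hm hne
        simp only [Finset.mem_filter, Finset.mem_univ, true_and] at hm
        have h1 : (m : ℕ) ≠ l := fun h => hne (Fin.ext h)
        rw [map_mul, block_one_of_le hm, map_smul, specialize_W_of_pos (by omega), smul_zero,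
          mul_zero]
      · simp
    rw [block_succ, ← Finset.sum_filter_add_sum_filter_not _ (fun m : Fin p => (m : ℕ) ≤ l),
      map_add, hdown, hup, Nat.choose_succ_succ, add_smul]

end FiniteW

namespace FiniteW

open Matrix

/-! ### Derivations and inverse power series over a noncommutative ring -/

section Series

variable {M : Type*} [Ring M]

/-- The series `∑ (-1)^k t_k x^k`. -/
noncomputable def altSeries (t : ℕ → M) : PowerSeries M := PowerSeries.mk fun k => (-1) ^ k * t k

/-- The coefficients of the inverse of `∑ (-1)^k t_k x^k`. -/
noncomputable def altInverse (t : ℕ → M) (k : ℕ) : M :=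
  PowerSeries.coeff k (PowerSeries.invOfUnit (altSeries t) 1)

variable {t : ℕ → M}

lemma coeff_altSeries (k : ℕ) : PowerSeries.coeff k (altSeries t) = (-1) ^ k * t k :=
  PowerSeries.coeff_mk _ _

lemma altSeries_mul_inv (h0 : t 0 = 1) :
    altSeries t * PowerSeries.invOfUnit (altSeries t) 1 = 1 :=
  PowerSeries.mul_invOfUnit _ _ (by simp [altSeries, h0])

lemma inv_mul_altSeries (h0 : t 0 = 1) :
    PowerSeries.invOfUnit (altSeries t) 1 * altSeries t = 1 :=
  PowerSeries.invOfUnit_mul _ _ (by simp [altSeries, h0])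

lemma altInverse_zero : altInverse t 0 = 1 := by
  simp [altInverse]

lemma altInverse_succ (h0 : t 0 = 1) (n : ℕ) : altInverse t (n + 1) =
    ∑ x ∈ Finset.HasAntidiagonal.antidiagonal n, (-1) ^ x.1 * (t (x.1 + 1) * altInverse t x.2) := by
  have h := congrArg (PowerSeries.coeff (n + 1)) (altSeries_mul_inv h0)
  rw [PowerSeries.coeff_mul, Finset.Nat.sum_antidiagonal_succ, PowerSeries.coeff_one,
    if_neg (Nat.succ_ne_zero n)] at h
  simp only [coeff_altSeries, h0, pow_zero, one_mul] at h
  rw [altInverse, eq_neg_of_add_eq_zero_left h, ← Finset.sum_neg_distrib]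
  refine Finset.sum_congr rfl fun x _ => ?_
  rw [altInverse, pow_succ]
  noncomm_ring

lemma altInverse_one (h0 : t 0 = 1) : altInverse t 1 = t 1 := by
  simp [altInverse_succ h0 0, altInverse_zero]

lemma altInverse_two (h0 : t 0 = 1) : altInverse t 2 = t 1 * t 1 - t 2 := by
  rw [altInverse_succ h0 1, Finset.Nat.sum_antidiagonal_succ]
  simp [altInverse_zero, altInverse_one h0, sub_eq_add_neg]

/-- The coefficientwise action of an additive map on power series. -/
noncomputable def coeffMap (δ : M →+ M) (f : PowerSeries M) : PowerSeries M :=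
  PowerSeries.mk fun k => δ (PowerSeries.coeff k f)

lemma coeffMap_mul (δ : M →+ M) (hδ : ∀ x y, δ (x * y) = δ x * y + x * δ y)
    (f g : PowerSeries M) : coeffMap δ (f * g) = coeffMap δ f * g + f * coeffMap δ g := by
  ext n
  simp only [coeffMap, PowerSeries.coeff_mk, PowerSeries.coeff_mul, map_sum, hδ,
    Finset.sum_add_distrib, map_add]

lemma coeffMap_one (δ : M →+ M) (hδ : ∀ x y, δ (x * y) = δ x * y + x * δ y) :
    coeffMap δ (1 : PowerSeries M) = 0 := by
  have h : δ 1 = 0 := by simpa using hδ 1 1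
  ext n
  rw [coeffMap, PowerSeries.coeff_mk, PowerSeries.coeff_one]
  split_ifs <;> simp [h]

lemma coeffMap_inv (δ : M →+ M) (hδ : ∀ x y, δ (x * y) = δ x * y + x * δ y)
    (h0 : t 0 = 1) : coeffMap δ (PowerSeries.invOfUnit (altSeries t) 1) =
      -(PowerSeries.invOfUnit (altSeries t) 1 * coeffMap δ (altSeries t) *
        PowerSeries.invOfUnit (altSeries t) 1) := by
  have h := coeffMap_mul δ hδ (altSeries t) (PowerSeries.invOfUnit (altSeries t) 1)
  rw [altSeries_mul_inv h0, coeffMap_one δ hδ] at h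
  have h2 := congrArg (PowerSeries.invOfUnit (altSeries t) 1 * ·) h
  simp only [mul_zero, mul_add, ← mul_assoc, inv_mul_altSeries h0, one_mul] at h2
  exact eq_neg_of_add_eq_zero_right h2.symm

/-- If δT = [E, T] and Q = T⁻¹, then δQ = -Q[E, T]Q = [E, Q]. -/
lemma derivation_altInverse_of_commutator (δ : M →+ M)
    (hδ : ∀ x y, δ (x * y) = δ x * y + x * δ y) (h0 : t 0 = 1) (E : M)
    (h : ∀ k, δ (t k) = E * t k - t k * E) (k : ℕ) :
    δ (altInverse t k) = E * altInverse t k - altInverse t k * E := by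
  have hneg : ∀ (k : ℕ) (x : M), δ ((-1) ^ k * x) = (-1) ^ k * δ x := fun k x => by
    rcases neg_one_pow_eq_or M k with h | h <;> simp [h]
  have hT : coeffMap δ (altSeries t) =
      PowerSeries.C E * altSeries t - altSeries t * PowerSeries.C E := by
    ext k
    simp only [coeffMap, altSeries, PowerSeries.coeff_mk, map_sub, PowerSeries.coeff_C_mul,
      PowerSeries.coeff_mul_C, hneg, h]
    rcases neg_one_pow_eq_or M k with h | h <;> rw [h] <;> noncomm_ring
  have hQ := coeffMap_inv δ hδ h0
  rw [hT] at hQ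
  set Q := PowerSeries.invOfUnit (altSeries t) 1 with hQdef
  have h1 : altSeries t * Q = 1 := altSeries_mul_inv h0
  have h2 : Q * altSeries t = 1 := inv_mul_altSeries h0
  have h3 : coeffMap δ Q = PowerSeries.C E * Q - Q * PowerSeries.C E := by
    rw [hQ]
    calc _ = (Q * altSeries t) * PowerSeries.C E * Q -
          Q * PowerSeries.C E * (altSeries t * Q) := by noncomm_ring
      _ = _ := by rw [h1, h2, one_mul, mul_one]
  have := congrArg (PowerSeries.coeff k) h3
  simpa only [coeffMap, PowerSeries.coeff_mk, map_sub, PowerSeries.coeff_C_mul,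
    PowerSeries.coeff_mul_C, altInverse, ← hQdef] using this

/-- The hypothesis reads xδT = [E, T] + x(E t₁ T - T t₁ E). Multiplying by Q = T⁻¹ on both sides and
changing sign gives xδQ = [E, Q] + x(t₁ E Q - Q E t₁). -/
lemma derivation_altInverse (δ : M →+ M)
    (hδ : ∀ x y, δ (x * y) = δ x * y + x * δ y) (h0 : t 0 = 1) (E : M)
    (h : ∀ k, δ (t k) = E * (t 1 * t k - t (k + 1)) - (t k * t 1 - t (k + 1)) * E) (k : ℕ) :
    δ (altInverse t k) = E * altInverse t (k + 1) - altInverse t (k + 1) * E +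
      t 1 * E * altInverse t k - altInverse t k * E * t 1 := by
  have hneg : ∀ (k : ℕ) (x : M), δ ((-1) ^ k * x) = (-1) ^ k * δ x := fun k x => by
    rcases neg_one_pow_eq_or M k with h | h <;> simp [h]
  -- The factor X absorbs the index shift in t (k + 1). The two terms -1 remove constant
  -- coefficients and cancel each other, since 1 commutes with E.
  have hT : PowerSeries.X * coeffMap δ (altSeries t) =
      PowerSeries.C E * (PowerSeries.X * (PowerSeries.C (t 1) * altSeries t) - 1 + altSeries t) -
      (PowerSeries.X * (altSeries t * PowerSeries.C (t 1)) - 1 + altSeries t) *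
        PowerSeries.C E := by
    ext k
    cases k with
    | zero => simp [altSeries, h0]
    | succ k =>
      simp only [coeffMap, altSeries, PowerSeries.coeff_mk, map_sub, map_add,
        PowerSeries.coeff_C_mul, PowerSeries.coeff_mul_C, PowerSeries.coeff_succ_X_mul,
        PowerSeries.coeff_one, if_neg (Nat.succ_ne_zero k), hneg, h, pow_succ]
      rcases neg_one_pow_eq_or M k with h | h <;> rw [h] <;> noncomm_ring
  have hQ := coeffMap_inv δ hδ h0
  set Q := PowerSeries.invOfUnit (altSeries t) 1 with hQdef
  have h1 : altSeries t * Q = 1 := altSeries_mul_inv h0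
  have h2 : Q * altSeries t = 1 := inv_mul_altSeries h0
  have hX : ∀ f : PowerSeries M, f * PowerSeries.X = PowerSeries.X * f :=
    fun f => PowerSeries.commute_X f
  have h3 : PowerSeries.X * coeffMap δ Q =
      PowerSeries.X * (PowerSeries.C (t 1) * (PowerSeries.C E * Q)) -
        PowerSeries.X * (Q * PowerSeries.C E * PowerSeries.C (t 1)) +
        (PowerSeries.C E * Q - Q * PowerSeries.C E) := by
    rw [hQ]
    calc _ = -(Q * (PowerSeries.X * coeffMap δ (altSeries t)) * Q) := by
          rw [mul_neg, ← mul_assoc, ← mul_assoc, ← hX Q, ← mul_assoc]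
      _ = (Q * PowerSeries.X) * altSeries t * PowerSeries.C (t 1) * PowerSeries.C E * Q -
          Q * (PowerSeries.C E * PowerSeries.X) * PowerSeries.C (t 1) * (altSeries t * Q) +
          ((Q * altSeries t) * PowerSeries.C E * Q -
          Q * PowerSeries.C E * (altSeries t * Q)) := by rw [hT]; noncomm_ring
      _ = PowerSeries.X * (Q * altSeries t) * PowerSeries.C (t 1) * PowerSeries.C E * Q -
          Q * (PowerSeries.X * PowerSeries.C E) * PowerSeries.C (t 1) * (altSeries t * Q) +
          ((Q * altSeries t) * PowerSeries.C E * Q -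
          Q * PowerSeries.C E * (altSeries t * Q)) := by
          rw [hX Q, hX (PowerSeries.C E)]; noncomm_ring
      _ = PowerSeries.X * (Q * altSeries t) * PowerSeries.C (t 1) * PowerSeries.C E * Q -
          (Q * PowerSeries.X) * PowerSeries.C E * PowerSeries.C (t 1) * (altSeries t * Q) +
          ((Q * altSeries t) * PowerSeries.C E * Q -
          Q * PowerSeries.C E * (altSeries t * Q)) := by noncomm_ring
      _ = _ := by rw [h1, h2, hX]; noncomm_ring
  have := congrArg (PowerSeries.coeff (k + 1)) h3
  simp only [coeffMap, PowerSeries.coeff_mk, map_sub, map_add, PowerSeries.coeff_C_mul,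
    PowerSeries.coeff_mul_C, PowerSeries.coeff_succ_X_mul] at this
  simp only [altInverse, ← hQdef, this]
  noncomm_ring

end Series

/-- Coefficient of x^(n+1) in (1 + x)^(-(q+1)) (1 + x)^(q+1) = 1. It identifies the specialised
inverse series. -/
lemma sum_antidiagonal_choose (q n : ℕ) : ∑ x ∈ Finset.HasAntidiagonal.antidiagonal n,
    (-1 : ℂ) ^ x.1 * ((q + (x.1 + 1)).choose (x.1 + 1) * (q + 1).choose x.2) =
      (q + 1).choose (n + 1) := by
  have h1 : (PowerSeries.mk fun n => ((q + n).choose q : ℂ)) *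
      (1 - PowerSeries.X) ^ (q + 1) = 1 := by
    rw [← PowerSeries.mk_one_pow_eq_mk_choose_add, ← mul_pow,
      PowerSeries.mk_one_mul_one_sub_eq_one, one_pow]
  have h2 := congrArg (PowerSeries.rescale (-1 : ℂ)) h1
  have h3 : PowerSeries.rescale (-1 : ℂ) ((1 - PowerSeries.X) ^ (q + 1)) =
      (((1 + Polynomial.X) ^ (q + 1) : Polynomial ℂ) : PowerSeries ℂ) := by
    rw [map_pow, map_sub, PowerSeries.rescale_neg_one_X, map_one, sub_neg_eq_add]
    simp
  rw [map_mul, map_one, h3] at h2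
  have h4 := congrArg (PowerSeries.coeff (n + 1)) h2
  rw [PowerSeries.coeff_mul, Finset.Nat.sum_antidiagonal_succ, PowerSeries.coeff_one,
    if_neg (Nat.succ_ne_zero n)] at h4
  simp only [PowerSeries.coeff_rescale, PowerSeries.coeff_mk, Polynomial.coeff_coe,
    Polynomial.coeff_one_add_X_pow, pow_zero, add_zero, Nat.choose_self, Nat.cast_one,
    one_mul] at h4
  rw [eq_neg_of_add_eq_zero_left h4, ← Finset.sum_neg_distrib]
  refine Finset.sum_congr rfl fun x _ => ?_
  rw [Nat.choose_symm_add, pow_succ]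
  ring

end FiniteW

namespace FiniteW

open Matrix

variable {N q : ℕ}

/-! ### The first family -/

variable (N q) in
/-- The sequence `1, ⁺W̄₀, ⁺W̄₁, …`. -/
noncomputable def plusSeq (k : ℕ) : Matrix (Fin N) (Fin N) (WAlgebra N (q + 1)) :=
  corner N q (q + k)

variable (N q) in
/-- The sequence `1, ⁻W̄₀, ⁻W̄₁, …`. -/
noncomputable def minusSeq : ℕ → Matrix (Fin N) (Fin N) (WAlgebra N (q + 1)) :=
  altInverse (plusSeq N q)

lemma corner_of_lt {n : ℕ} (h : n < q) : corner N q n = 0 :=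
  block_eq_zero (by simpa using h)

lemma plusSeq_zero : plusSeq N q 0 = 1 := block_eq_one (by simp)

lemma plusSeq_mem_homogeneous (k : ℕ) : plusSeq N q k ∈ homogeneous N (q + 1) k :=
  block_mem_homogeneous (by simp)

lemma plusSeq_succ_sub_mem_decomposable (j : ℕ) : plusSeq N q (j + 1) -
    linearPart (q + 1) j (q + 1 + j) (Fin.last q) 0 • W N (q + 1) j ∈
      decomposable N (q + 1) (j + 1) := by
  rw [show q + 1 + j = q + (j + 1) by ring]
  exact block_sub_mem_decomposable (by simp)

lemma specialize_plusSeq (k : ℕ) : (specialize N (q + 1)).mapMatrix (plusSeq N q k) =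
    (q + k).choose k • constMatrix N ^ k :=
  specialize_block (by simp)

/-! ### The second family -/

lemma minusSeq_zero : minusSeq N q 0 = 1 := altInverse_zero

lemma neg_one_pow_mul_eq_smul (i : ℕ) (A : Matrix (Fin N) (Fin N) (WAlgebra N (q + 1))) :
    (-1) ^ i * A = (-1 : ℂ) ^ i • A := by
  rcases Nat.even_or_odd i with h | h <;> simp [h.neg_one_pow]

lemma minusSeq_succ (n : ℕ) : minusSeq N q (n + 1) =
    ∑ x ∈ Finset.HasAntidiagonal.antidiagonal n,
      (-1 : ℂ) ^ x.1 • (plusSeq N q (x.1 + 1) * minusSeq N q x.2) := by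
  rw [minusSeq, altInverse_succ plusSeq_zero]
  simp only [neg_one_pow_mul_eq_smul]

lemma minusSeq_mem_homogeneous (k : ℕ) : minusSeq N q k ∈ homogeneous N (q + 1) k := by
  induction k using Nat.strong_induction_on with
  | _ k ih =>
    cases k with
    | zero => rw [minusSeq_zero]; exact one_mem_homogeneous
    | succ n =>
      rw [minusSeq_succ]
      refine Submodule.sum_mem _ fun x hx => Submodule.smul_mem _ _ ?_
      rw [Finset.HasAntidiagonal.mem_antidiagonal] at hx
      have := mul_mem_homogeneous (plusSeq_mem_homogeneous (N := N) (q := q) (x.1 + 1))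
        (ih x.2 (by omega))
      rwa [show x.1 + 1 + x.2 = n + 1 by omega] at this

lemma minusSeq_succ_sub_mem_decomposable (j : ℕ) : minusSeq N q (j + 1) -
    ((-1) ^ j * linearPart (q + 1) j (q + 1 + j) (Fin.last q) 0) • W N (q + 1) j ∈
      decomposable N (q + 1) (j + 1) := by
  -- The pair (j, 0) carries the linear term; every other pair is a product of two factors of
  -- positive weight.
  have hmem : (j, 0) ∈ Finset.HasAntidiagonal.antidiagonal j := by simp
  rw [minusSeq_succ, ← Finset.add_sum_erase _ _ hmem, minusSeq_zero, mul_one, mul_smul,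
    add_sub_right_comm, ← smul_sub]
  refine Submodule.add_mem _ (Submodule.smul_mem _ _ (plusSeq_succ_sub_mem_decomposable j)) ?_
  refine Submodule.sum_mem _ fun x hx => Submodule.smul_mem _ _ ?_
  rw [Finset.mem_erase, Finset.HasAntidiagonal.mem_antidiagonal] at hx
  have hpos : 0 < x.2 := Nat.pos_of_ne_zero fun h => hx.1 (Prod.ext (by simp only; omega) h)
  have := mul_mem_decomposable (plusSeq_mem_homogeneous (N := N) (q := q) (x.1 + 1))
    (minusSeq_mem_homogeneous (N := N) (q := q) x.2) (by omega) hpos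
  rwa [show x.1 + 1 + x.2 = j + 1 by omega] at this

lemma specialize_minusSeq (k : ℕ) : (specialize N (q + 1)).mapMatrix (minusSeq N q k) =
    (q + 1).choose k • constMatrix N ^ k := by
  induction k using Nat.strong_induction_on with
  | _ k ih =>
    cases k with
    | zero => rw [minusSeq_zero, map_one]; simp
    | succ n =>
      have h : ∀ x ∈ Finset.HasAntidiagonal.antidiagonal n, (specialize N (q + 1)).mapMatrix
          ((-1 : ℂ) ^ x.1 • (plusSeq N q (x.1 + 1) * minusSeq N q x.2)) =
          ((-1 : ℂ) ^ x.1 * ((q + (x.1 + 1)).choose (x.1 + 1) * (q + 1).choose x.2)) •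
            constMatrix N ^ (n + 1) := by
        intro x hx
        rw [Finset.HasAntidiagonal.mem_antidiagonal] at hx
        rw [map_smul, map_mul, specialize_plusSeq, ih x.2 (by omega), smul_mul_smul_comm,
          ← pow_add, show x.1 + 1 + x.2 = n + 1 by omega, ← Nat.cast_smul_eq_nsmul ℂ, smul_smul]
        push_cast
        rfl
      rw [minusSeq_succ, map_sum, Finset.sum_congr rfl h, ← Finset.sum_smul,
        sum_antidiagonal_choose, Nat.cast_smul_eq_nsmul]

/-! ### The first two elements -/

lemma decomposable_one : decomposable N (q + 1) 1 = ⊥ := by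
  rw [decomposable, Submodule.span_eq_bot]
  rintro _ ⟨s, hs, h2, -⟩
  have := length_le_wordWeight s
  omega

lemma exists_eq_smul_of_mem_decomposable_two {A : Matrix (Fin N) (Fin N) (WAlgebra N (q + 1))}
    (hA : A ∈ decomposable N (q + 1) 2) :
    ∃ c : ℂ, A = c • (W N (q + 1) 0 * W N (q + 1) 0) := by
  have : decomposable N (q + 1) 2 ≤ Submodule.span ℂ {W N (q + 1) 0 * W N (q + 1) 0} := by
    refine Submodule.span_le.mpr ?_
    rintro _ ⟨s, hs, h2, rfl⟩
    have hlen := length_le_wordWeight s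
    obtain ⟨x, y, rfl⟩ := List.length_eq_two.mp (show s.length = 2 by omega)
    simp only [wordWeight, List.map_cons, List.map_nil, List.sum_cons, List.sum_nil] at hs
    obtain rfl : x = 0 := by omega
    obtain rfl : y = 0 := by omega
    exact Submodule.subset_span (by simp [word])
  obtain ⟨c, hc⟩ := Submodule.mem_span_singleton.mp (this hA)
  exact ⟨c, hc.symm⟩

lemma eq_of_smul_constMatrix_pow_eq (hN : 1 ≤ N) {c c' : ℂ} {n : ℕ}
    (h : c • constMatrix N ^ (n + 1) = c' • constMatrix N ^ (n + 1)) : c = c' := by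
  have h1 := congrFun (congrFun h ⟨0, hN⟩) ⟨0, hN⟩
  rw [Matrix.smul_apply, Matrix.smul_apply, constMatrix_pow_apply] at h1
  refine smul_left_injective ℂ ?_ h1
  exact mul_ne_zero (pow_ne_zero _ (by exact_mod_cast (by omega : N ≠ 0)))
    (pow_ne_zero _ Polynomial.X_ne_zero)

lemma plusSeq_one (hN : 1 ≤ N) : plusSeq N q 1 = ((q + 1 : ℕ) : ℂ) • W N (q + 1) 0 := by
  have h := plusSeq_succ_sub_mem_decomposable (N := N) (q := q) 0
  rw [zero_add, decomposable_one, Submodule.mem_bot, sub_eq_zero] at h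
  have h1 := congrArg (specialize N (q + 1)).mapMatrix h
  rw [specialize_plusSeq, map_smul, specialize_W_zero (Nat.succ_pos q),
    ← Nat.cast_smul_eq_nsmul ℂ, Nat.choose_one_right] at h1
  rw [h, ← eq_of_smul_constMatrix_pow_eq (n := 0) (c := ((q + 1 : ℕ) : ℂ))
    (c' := linearPart (q + 1) 0 (q + 1 + 0) (Fin.last q) 0) hN (by simpa using h1)]

/-- The only decomposable word of weight 2 is W_0 W_0, so one specialisation determines its
coefficient, the binomial coefficient of p + 1 over 2. -/
lemma plusSeq_two (hN : 1 ≤ N) : plusSeq N q 2 =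
    (((q + 1 : ℕ) : ℂ) * (((q + 1 : ℕ) : ℂ) ^ 2 - 1) / 6) • W N (q + 1) 1 +
      (((q + 1 : ℕ) : ℂ) * (((q + 1 : ℕ) : ℂ) + 1) / 2) • (W N (q + 1) 0 * W N (q + 1) 0) := by
  have h := plusSeq_succ_sub_mem_decomposable (N := N) (q := q) 1
  obtain ⟨c, hc⟩ := exists_eq_smul_of_mem_decomposable_two h
  rw [linearPart_corner_one, sub_eq_iff_eq_add'] at hc
  have h1 := congrArg (specialize N (q + 1)).mapMatrix hc
  rw [specialize_plusSeq, map_add, map_smul, map_smul, map_mul,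
    specialize_W_zero (Nat.succ_pos q), specialize_W_of_pos one_pos, smul_zero, zero_add,
    ← Nat.cast_smul_eq_nsmul ℂ, ← pow_two] at h1
  rw [hc, ← eq_of_smul_constMatrix_pow_eq (n := 1) hN h1, Nat.cast_choose_two]
  push_cast
  ring_nf

/-! ### Poisson brackets -/

lemma single_mul_entry (A : Matrix (Fin N) (Fin N) (WAlgebra N (q + 1))) (a b c d : Fin N) :
    (single b a (1 : WAlgebra N (q + 1)) * A) c d = if c = b then A a d else 0 := by
  split_ifs with h
  · subst h
    rw [single_mul_apply_same, one_mul]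
  · rw [single_mul_apply_of_ne (h := h)]

lemma mul_single_entry (A : Matrix (Fin N) (Fin N) (WAlgebra N (q + 1))) (a b c d : Fin N) :
    (A * single b a (1 : WAlgebra N (q + 1))) c d = if a = d then A c b else 0 := by
  split_ifs with h
  · subst h
    rw [mul_single_apply_same, mul_one]
  · rw [mul_single_apply_of_ne (hbj := Ne.symm h)]

lemma mul_single_mul_entry (A B : Matrix (Fin N) (Fin N) (WAlgebra N (q + 1))) (a b c d : Fin N) :
    (A * single b a (1 : WAlgebra N (q + 1)) * B) c d = A c b * B a d := by
  rw [mul_apply]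
  simp only [mul_single_entry, ite_mul, zero_mul, Finset.sum_ite_eq, Finset.mem_univ, if_true]

lemma corner_self : corner N q q = 1 := plusSeq_zero

/-- Corners below the power q vanish and the corner of J^q is 1, so one term of each sum survives.
Left or right multiplication by E_{ba} encodes the Kronecker deltas. -/
lemma wBracket_plusSeq_one (k : ℕ) (a b c d : Fin N) :
    wBracket N (q + 1) (plusSeq N q 1 a b) (plusSeq N q k c d) =
      (single b a (1 : WAlgebra N (q + 1)) * plusSeq N q k -
        plusSeq N q k * single b a (1 : WAlgebra N (q + 1))) c d := by
  rw [Matrix.sub_apply, single_mul_entry, mul_single_entry, plusSeq, plusSeq, wBracket_corner,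
    Finset.sum_sub_distrib]
  congr 1
  · rw [Finset.sum_range_succ', Finset.sum_eq_zero, zero_add]
    · rw [show q + 1 - 1 - 0 = q by omega, corner_self, add_zero, one_apply, mul_ite, mul_one,
        mul_zero]
    · intro i hi
      rw [Finset.mem_range] at hi
      rw [corner_of_lt (n := q + 1 - 1 - (i + 1)) (by omega), Matrix.zero_apply, mul_zero]
  · rw [Finset.sum_range_succ, Finset.sum_eq_zero, zero_add]
    · rw [show q + 1 + (q + k) - 1 - q = q + k by omega, corner_self, one_apply, ite_mul, one_mul,
        zero_mul]
    · intro i hi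
      rw [corner_of_lt (Finset.mem_range.mp hi), Matrix.zero_apply, zero_mul]

/-- Here two terms of each sum survive: the factor with power q gives a commutator term, the factor
with power q + 1 a quadratic term. -/
lemma wBracket_plusSeq_two (k : ℕ) (a b c d : Fin N) :
    wBracket N (q + 1) (plusSeq N q 2 a b) (plusSeq N q k c d) =
      (single b a (1 : WAlgebra N (q + 1)) * plusSeq N q (k + 1) -
        plusSeq N q (k + 1) * single b a (1 : WAlgebra N (q + 1)) +
        plusSeq N q 1 * single b a (1 : WAlgebra N (q + 1)) * plusSeq N q k -
        plusSeq N q k * single b a (1 : WAlgebra N (q + 1)) * plusSeq N q 1) c d := by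
  rw [Matrix.sub_apply, Matrix.add_apply, Matrix.sub_apply, single_mul_entry, mul_single_entry,
    mul_single_mul_entry, mul_single_mul_entry]
  have h1 : ∑ i ∈ Finset.range (q + 2),
      corner N q (q + k + i) a d * corner N q (q + 2 - 1 - i) c b =
      plusSeq N q 1 c b * plusSeq N q k a d + if c = b then plusSeq N q (k + 1) a d else 0 := by
    rw [Finset.sum_range_succ', Finset.sum_range_succ', Finset.sum_eq_zero, zero_add]
    · rw [show q + 2 - 1 - (0 + 1) = q by omega, show q + 2 - 1 - 0 = q + 1 by omega, corner_self,
        one_apply, mul_ite, mul_one, mul_zero]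
      exact (add_comm _ _).trans (congrArg₂ _ (mul_comm _ _) rfl)
    · intro i hi
      rw [Finset.mem_range] at hi
      rw [corner_of_lt (n := q + 2 - 1 - (i + 1 + 1)) (by omega), Matrix.zero_apply, mul_zero]
  have h2 : ∑ i ∈ Finset.range (q + 2),
      corner N q i a d * corner N q (q + 2 + (q + k) - 1 - i) c b =
      (if a = d then plusSeq N q (k + 1) c b else 0) + plusSeq N q k c b * plusSeq N q 1 a d := by
    rw [Finset.sum_range_succ, Finset.sum_range_succ, Finset.sum_eq_zero, zero_add]
    · rw [show q + 2 + (q + k) - 1 - q = q + (k + 1) by omega,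
        show q + 2 + (q + k) - 1 - (q + 1) = q + k by omega, corner_self, one_apply, ite_mul,
        one_mul, zero_mul, mul_comm (corner N q (q + 1) a d)]
      rfl
    · intro i hi
      rw [corner_of_lt (Finset.mem_range.mp hi), Matrix.zero_apply, zero_mul]
  rw [plusSeq, plusSeq, wBracket_corner, Finset.sum_sub_distrib, h1, h2]
  simp only [plusSeq]
  ring

/-! ### Brackets of the second family. -/

lemma exists_derivation_wBracket_right (N p : ℕ) (f : WAlgebra N p) :
    ∃ D : Derivation ℂ (WAlgebra N p) (WAlgebra N p), ∀ g, wBracket N p f g = D g :=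
  ⟨_, fun g => (biderivationRight_apply _ f g).symm⟩

lemma exists_derivation_wBracket_left (N p : ℕ) (g : WAlgebra N p) :
    ∃ D : Derivation ℂ (WAlgebra N p) (WAlgebra N p), ∀ f, wBracket N p f g = D f :=
  ⟨_, fun f => (biderivationLeft_apply _ f g).symm⟩

/-- As matrix entries commute, the entrywise bracket is a derivation of the noncommutative matrix
ring, so the inverse series computations apply to it. -/
lemma exists_matrix_derivation (f : WAlgebra N (q + 1)) :
    ∃ δ : Matrix (Fin N) (Fin N) (WAlgebra N (q + 1)) →+
        Matrix (Fin N) (Fin N) (WAlgebra N (q + 1)),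
      (∀ A B, δ (A * B) = δ A * B + A * δ B) ∧
        ∀ A c d, δ A c d = wBracket N (q + 1) f (A c d) := by
  obtain ⟨D, hD⟩ := exists_derivation_wBracket_right N (q + 1) f
  refine ⟨(D : WAlgebra N (q + 1) →ₗ[ℂ] WAlgebra N (q + 1)).toAddMonoidHom.mapMatrix,
    fun A B => ?_, fun A c d => (hD _).symm⟩
  ext1 c d
  change D ((A * B) c d) = (A.map D * B) c d + (A * B.map D) c d
  simp only [mul_apply, map_sum, Derivation.leibniz, smul_eq_mul, Finset.sum_add_distrib,
    map_apply]
  refine (add_comm _ _).trans (congrArg₂ _ ?_ rfl)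
  exact Finset.sum_congr rfl fun _ _ => mul_comm _ _

lemma minusSeq_one : minusSeq N q 1 = plusSeq N q 1 := altInverse_one plusSeq_zero

lemma minusSeq_two : minusSeq N q 2 = plusSeq N q 1 * plusSeq N q 1 - plusSeq N q 2 :=
  altInverse_two plusSeq_zero

lemma wBracket_minusSeq_one (k : ℕ) (a b c d : Fin N) :
    wBracket N (q + 1) (minusSeq N q 1 a b) (minusSeq N q k c d) =
      (single b a (1 : WAlgebra N (q + 1)) * minusSeq N q k -
        minusSeq N q k * single b a (1 : WAlgebra N (q + 1))) c d := by
  obtain ⟨δ, hδ, hδ'⟩ := exists_matrix_derivation (N := N) (q := q) (plusSeq N q 1 a b)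
  rw [minusSeq_one, ← hδ', minusSeq, derivation_altInverse_of_commutator δ hδ plusSeq_zero
    (single b a (1 : WAlgebra N (q + 1)))]
  intro k
  ext1 c d
  rw [hδ', wBracket_plusSeq_one]

/-- Passing from t₂ to t₁² - t₂ cancels the terms with E in the middle, leaving the form that
`derivation_altInverse` requires. -/
lemma commutator_sub_commutator {M : Type*} [Ring M] (E s x y : M) :
    (E * (s * x) - x * E * s + s * E * x - x * s * E) -
      (E * y - y * E + s * E * x - x * E * s) = E * (s * x - y) - (x * s - y) * E := by
  noncomm_ring

lemma wBracket_minusSeq_two_plusSeq (k : ℕ) (a b c d : Fin N) :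
    wBracket N (q + 1) (minusSeq N q 2 a b) (plusSeq N q k c d) =
      (single b a (1 : WAlgebra N (q + 1)) * (plusSeq N q 1 * plusSeq N q k - plusSeq N q (k + 1)) -
        (plusSeq N q k * plusSeq N q 1 - plusSeq N q (k + 1)) *
          single b a (1 : WAlgebra N (q + 1))) c d := by
  obtain ⟨D, hD⟩ := exists_derivation_wBracket_left N (q + 1) (plusSeq N q k c d)
  have h1 : wBracket N (q + 1) ((plusSeq N q 1 * plusSeq N q 1) a b) (plusSeq N q k c d) =
      (single b a (1 : WAlgebra N (q + 1)) * (plusSeq N q 1 * plusSeq N q k) -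
        plusSeq N q k * single b a (1 : WAlgebra N (q + 1)) * plusSeq N q 1 +
        plusSeq N q 1 * single b a (1 : WAlgebra N (q + 1)) * plusSeq N q k -
        plusSeq N q k * plusSeq N q 1 * single b a (1 : WAlgebra N (q + 1))) c d := by
    rw [hD, mul_apply, map_sum]
    simp only [Derivation.leibniz, smul_eq_mul, Finset.sum_add_distrib]
    simp only [← hD, wBracket_plusSeq_one]
    simp only [Matrix.sub_apply, Matrix.add_apply, single_mul_entry, mul_single_entry,
      mul_single_mul_entry, mul_sub, mul_ite, mul_zero, Finset.sum_sub_distrib,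
      Finset.sum_ite_eq, Finset.sum_ite_eq', Finset.mem_univ, if_true]
    simp only [mul_apply]
    have h2 : ∀ P : Prop, [Decidable P] → ∀ F : Fin N → WAlgebra N (q + 1),
        (∑ x, if P then F x else 0) = if P then ∑ x, F x else 0 := by
      intro P _ F
      split_ifs <;> simp
    have h3 : ∑ x, plusSeq N q 1 x b * plusSeq N q k c x =
        ∑ x, plusSeq N q k c x * plusSeq N q 1 x b := Finset.sum_congr rfl fun _ _ => mul_comm _ _
    simp only [h2, h3]
    rw [mul_comm (plusSeq N q 1 a d)]
    exact (add_sub_assoc _ _ _).symm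
  have h2 : wBracket N (q + 1) (minusSeq N q 2 a b) (plusSeq N q k c d) =
      wBracket N (q + 1) ((plusSeq N q 1 * plusSeq N q 1) a b) (plusSeq N q k c d) -
        wBracket N (q + 1) (plusSeq N q 2 a b) (plusSeq N q k c d) := by
    rw [hD, hD, hD, minusSeq_two, Matrix.sub_apply, map_sub]
  rw [h2, h1, wBracket_plusSeq_two, ← Matrix.sub_apply, commutator_sub_commutator]

lemma wBracket_minusSeq_two (k : ℕ) (a b c d : Fin N) :
    wBracket N (q + 1) (minusSeq N q 2 a b) (minusSeq N q k c d) =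
      (single b a (1 : WAlgebra N (q + 1)) * minusSeq N q (k + 1) -
        minusSeq N q (k + 1) * single b a (1 : WAlgebra N (q + 1)) +
        minusSeq N q 1 * single b a (1 : WAlgebra N (q + 1)) * minusSeq N q k -
        minusSeq N q k * single b a (1 : WAlgebra N (q + 1)) * minusSeq N q 1) c d := by
  obtain ⟨δ, hδ, hδ'⟩ := exists_matrix_derivation (N := N) (q := q) (minusSeq N q 2 a b)
  rw [← hδ', minusSeq_one]
  conv_lhs => rw [minusSeq]
  rw [derivation_altInverse δ hδ plusSeq_zero (single b a (1 : WAlgebra N (q + 1)))]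
  · rfl
  · intro k
    ext1 c d
    rw [hδ', wBracket_minusSeq_two_plusSeq]

/-! ### The two families -/

variable (N q) in
/-- The elements `1, ᵋW̄₀, ᵋW̄₁, …` for either sign. -/
noncomputable def signedSeq (ε : ℤˣ) : ℕ → Matrix (Fin N) (Fin N) (WAlgebra N (q + 1)) :=
  if ε = 1 then plusSeq N q else minusSeq N q

lemma signedSeq_one : signedSeq N q 1 = plusSeq N q := if_pos rfl

lemma signedSeq_neg_one : signedSeq N q (-1) = minusSeq N q := if_neg (by decide)

lemma signedSeq_cases {P : (ℕ → Matrix (Fin N) (Fin N) (WAlgebra N (q + 1))) → Prop}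
    (h1 : P (plusSeq N q)) (h2 : P (minusSeq N q)) (ε : ℤˣ) : P (signedSeq N q ε) := by
  rw [signedSeq]
  split_ifs
  exacts [h1, h2]

lemma signedSeq_succ_sub_mem_decomposable (ε : ℤˣ) (j : ℕ) (hj : j < q + 1) :
    ∃ c : ℂ, c ≠ 0 ∧ signedSeq N q ε (j + 1) - c • W N (q + 1) j ∈
      decomposable N (q + 1) (j + 1) :=
  signedSeq_cases (P := fun V => ∃ c : ℂ, c ≠ 0 ∧ V (j + 1) - c • W N (q + 1) j ∈
      decomposable N (q + 1) (j + 1))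
    ⟨_, linearPart_corner_ne_zero q j hj, plusSeq_succ_sub_mem_decomposable j⟩
    ⟨_, mul_ne_zero (pow_ne_zero _ (by norm_num)) (linearPart_corner_ne_zero q j hj),
      minusSeq_succ_sub_mem_decomposable j⟩ ε

lemma delta_mul (a b : Fin N) (f : WAlgebra N (q + 1)) :
    delta N (q + 1) a b * f = if a = b then f else 0 := by
  rw [delta, ite_mul, one_mul, zero_mul]

lemma wBracket_signedSeq_one (ε : ℤˣ) (k : ℕ) (a b c d : Fin N) :
    wBracket N (q + 1) (signedSeq N q ε 1 a b) (signedSeq N q ε k c d) =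
      delta N (q + 1) c b * signedSeq N q ε k a d -
        delta N (q + 1) a d * signedSeq N q ε k c b := by
  rw [delta_mul, delta_mul, ← single_mul_entry, ← mul_single_entry, ← Matrix.sub_apply]
  rcases Int.units_eq_one_or ε with rfl | rfl
  · rw [signedSeq_one, wBracket_plusSeq_one]
  · rw [signedSeq_neg_one, wBracket_minusSeq_one]

lemma wBracket_signedSeq_two (ε : ℤˣ) (k : ℕ) (a b c d : Fin N) :
    wBracket N (q + 1) (signedSeq N q ε 2 a b) (signedSeq N q ε k c d) =
      delta N (q + 1) c b * signedSeq N q ε (k + 1) a d -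
        delta N (q + 1) a d * signedSeq N q ε (k + 1) c b +
        signedSeq N q ε 1 c b * signedSeq N q ε k a d -
        signedSeq N q ε k c b * signedSeq N q ε 1 a d := by
  rw [delta_mul, delta_mul, ← single_mul_entry, ← mul_single_entry, ← Matrix.sub_apply,
    ← mul_single_mul_entry, ← mul_single_mul_entry, ← Matrix.add_apply, ← Matrix.sub_apply]
  rcases Int.units_eq_one_or ε with rfl | rfl
  · rw [signedSeq_one, wBracket_plusSeq_two]
  · rw [signedSeq_neg_one, wBracket_minusSeq_two]

end FiniteW

theorem mainTheorem6 (N p : ℕ) (hN : 1 ≤ N) (hp : 1 ≤ p) :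
    -- the two families, labelled by the sign `ε = ±1`
    ∃ Wbar : ℤˣ → ℕ → Matrix (Fin N) (Fin N) (FiniteW.WAlgebra N p),
      -- the first two generators of each family
      (∀ ε, Wbar ε 0 = (p : ℂ) • FiniteW.W N p 0) ∧
      (∀ ε : ℤˣ, Wbar ε 1 =
        (((ε : ℤ) : ℂ) * ((p : ℂ) * ((p : ℂ) ^ 2 - 1) / 6)) • FiniteW.W N p 1 +
          ((p : ℂ) * ((p : ℂ) + ((ε : ℤ) : ℂ)) / 2) • (FiniteW.W N p 0 * FiniteW.W N p 0)) ∧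
      -- polynomial form in the original generators
      (∃ α : ℤˣ → (n : ℕ) → (Fin n → ℕ) → ℂ, ∀ ε j, Wbar ε j =
        ∑ n ∈ Finset.Icc 1 (j + 1), ∑ s ∈ Finset.Nat.antidiagonalTuple n (j + 1 - n),
          α ε n s • (List.ofFn fun i => FiniteW.W N p (s i)).prod) ∧
      -- degree in the original generators
      (∀ ε j a b, (ε = 1 ∨ j < p) → (Wbar ε j a b).totalDegree = j + 1) ∧
      -- Poisson brackets with the first two generators
      (∀ ε j a b c d, FiniteW.wBracket N p (Wbar ε 0 a b) (Wbar ε j c d) =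
        FiniteW.delta N p c b * Wbar ε j a d - FiniteW.delta N p a d * Wbar ε j c b) ∧
      (∀ ε j a b c d, FiniteW.wBracket N p (Wbar ε 1 a b) (Wbar ε j c d) =
        FiniteW.delta N p c b * Wbar ε (j + 1) a d - FiniteW.delta N p a d * Wbar ε (j + 1) c b +
          Wbar ε 0 c b * Wbar ε j a d - Wbar ε j c b * Wbar ε 0 a d) ∧
      -- the generators with `j < p` form a basis of generators
      (∀ ε, AlgebraicIndependent ℂ
        (fun i : Fin p × Fin N × Fin N => Wbar ε i.1 i.2.1 i.2.2)) ∧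
      (∀ ε, Algebra.adjoin ℂ
        (Set.range fun i : Fin p × Fin N × Fin N => Wbar ε i.1 i.2.1 i.2.2) = ⊤) ∧
      -- the other generators are polynomials in these
      (∀ ε j a b, p ≤ j → Wbar ε j a b ∈ Algebra.adjoin ℂ
        (Set.range fun i : Fin p × Fin N × Fin N => Wbar ε i.1 i.2.1 i.2.2)) := by
  obtain ⟨q, rfl⟩ : ∃ q, p = q + 1 := ⟨p - 1, by omega⟩
  open FiniteW in
  have hadj := fun ε => adjoin_range_eq_top (fun j => signedSeq N q ε (j + 1))
    (signedSeq_succ_sub_mem_decomposable ε)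
  refine ⟨fun ε j => FiniteW.signedSeq N q ε (j + 1), ?_, ?_, ?_, ?_, ?_, ?_, ?_, hadj, ?_⟩
  · exact FiniteW.signedSeq_cases (P := fun V => V 1 = _) (FiniteW.plusSeq_one hN)
      (FiniteW.minusSeq_one.trans (FiniteW.plusSeq_one hN))
  · intro ε
    rcases Int.units_eq_one_or ε with rfl | rfl
    · simp only [FiniteW.signedSeq_one]
      rw [FiniteW.plusSeq_two hN]
      norm_num
    · simp only [FiniteW.signedSeq_neg_one]
      -- The coefficient of W_0 W_0 becomes p² - p(p+1)/2 = p(p-1)/2.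
      rw [FiniteW.minusSeq_two, FiniteW.plusSeq_two hN,
        FiniteW.plusSeq_one hN, smul_mul_smul_comm]
      push_cast
      module
  · have h := fun ε j => FiniteW.exists_coefficients (FiniteW.signedSeq_cases (q := q) (N := N)
      (P := fun V => V (j + 1) ∈ FiniteW.homogeneous N (q + 1) (j + 1))
      (FiniteW.plusSeq_mem_homogeneous _) (FiniteW.minusSeq_mem_homogeneous _) ε)
    choose α hα using h
    -- The coefficients may not depend on j separately, but j = n + |s| - 1 is determined by the
    -- word.
    refine ⟨fun ε n s => α ε (n + ∑ i, s i - 1) n s, fun ε j => (hα ε j).trans ?_⟩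
    refine Finset.sum_congr rfl fun n hn => Finset.sum_congr rfl fun s hs => ?_
    rw [Finset.mem_Icc] at hn
    rw [Finset.Nat.mem_antidiagonalTuple] at hs
    simp only
    rw [hs, show n + (j + 1 - n) - 1 = j by omega]
  · intro ε j a b h
    rcases Int.units_eq_one_or ε with rfl | rfl
    · simp only [FiniteW.signedSeq_one]
      exact FiniteW.totalDegree_eq_of_specialize (FiniteW.plusSeq_mem_homogeneous _)
        (Nat.choose_pos (by omega)).ne' (FiniteW.specialize_plusSeq _) a b
    -- The binomial coefficient of p over j + 1 is nonzero exactly because j + 1 ≤ p.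
    · have hj : j < q + 1 := h.resolve_left (by decide)
      simp only [FiniteW.signedSeq_neg_one]
      exact FiniteW.totalDegree_eq_of_specialize (FiniteW.minusSeq_mem_homogeneous _)
        (Nat.choose_pos (by omega)).ne' (FiniteW.specialize_minusSeq _) a b
  · exact fun ε j => FiniteW.wBracket_signedSeq_one ε (j + 1)
  · exact fun ε j => FiniteW.wBracket_signedSeq_two ε (j + 1)
  · exact fun ε => FiniteW.algebraicIndependent_of_adjoin_eq_top _ (hadj ε)
  · intro ε j a b _
    rw [hadj]
    exact Algebra.mem_top
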